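/- Let $\theta\in(0,1]$. Let $\lambda_t\ge 0$ ($t\ge 0$) be measurable with $\Lambda_t=\int_0^t\lambda_u\,du<\infty$ for all $t\ge0$, let $a_t$ be measurable with $0\le a_t\le 1+1/\theta$, and let $p_t$ be a probability law on $\{0,1,2,\dots\}$, depending measurably on $t$, with generating function $$h_t(s)=\sum_{k\ge0}p_t(k)s^k=1-a_t(1-s)+\frac{a_t}{1+\theta}(1-s)^{1+\theta},\qquad 0\le s\le1 .$$ Let $(Z_t)_{t\ge0}$, $Z_0=1$, be the (theta-positive) Markov branching process in this varying environment: individuals live and reproduce independently of each other, an individual alive at time $t$ dies at rate $\lambda_t$, and an individual dying at time $t$ is replaced by $k$ offspring with probability $p_t(k)$. That is, $Z$ is a càdlàg process with values in $\{0,1,2,\dots\}$ that jumps from $i$ to $i-1+k$ at rate $i\lambda_tp_t(k)$ at time $t$ (it solves the martingale problem for the corresponding generators, with finitely supported test functions). Put $$\mu_t=\exp\Big\{\int_0^t(a_u-1)\lambda_u\,du\Big\},\qquad V_{t,\theta}=\frac{\theta}{1+\theta}\int_0^t\mu_u^{-\theta}\lambda_u\,du,\qquad V_\theta=\lim_{t\to\infty}V_{t,\theta},\qquad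 m_t=\mathrm E(Z_t\mid Z_t>0).$$ Here, for every $t\ge 0$, $\mathrm P(Z_t>0)>0$ and $Z_t$ is integrable with $\mathrm E(Z_t)=\mu_t$. The process is called critical if $\lim_{t\to\infty}\mathrm P(Z_t=0)=1$ and $\lim_{t\to\infty}m_t=\infty$. The process is critical if and only if $V_\theta=\infty$ and $\mu_t^\theta V_{t,\theta}\to\infty$ as $t\to\infty$. In this case, as $t\to\infty$, $$\mathrm P(Z_t>0)\sim V_{t,\theta}^{-1/\theta},\qquad m_t\sim\mu_tV_{t,\theta}^{1/\theta},$$ and for every $w\ge0$ $$\lim_{t\to\infty}\mathrm E\big(e^{-wZ_t/m_t}\mid Z_t>0\big)=1-(1+w^{-\theta})^{-1/\theta},$$ where the right-hand side is read as $1$ for $w=0$ (that is, $0^{-\theta}=\infty$). -/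

import Mathlib

open MeasureTheory ProbabilityTheory Filter Topology Asymptotics
open scoped NNReal ENNReal

noncomputable section

namespace ThetaBranching

/-- The generator at time `t` of the population size of a Markov branching process in varying
environment: in a population of `i` individuals each one dies, independently of the others, at
rate `lam t`, and is then replaced by `k` offspring with probability `p t k`, so that the
population jumps from `i` to `i - 1 + k` at rate `i * lam t * p t k`. (For `i = 0` the factor `i`
vanishes, so the truncated subtraction is harmless.) -/
def generator (lam : ℝ → ℝ) (p : ℝ → PMF ℕ) (t : ℝ) (f : ℕ → ℝ) (i : ℕ) : ℝ :=
  (i : ℝ) * lam t * ∑' k : ℕ, (p t k).toReal * (f (i + k - 1) - f i)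

/-- `Z` is a Markov branching process, started from one individual, in the varying environment
with death rates `lam` and offspring laws `p`: an adapted càdlàg process with values in `ℕ`
(non-explosive) that solves the martingale problem for `generator lam p`, with the finitely
supported functions on `ℕ` as test functions. -/
structure IsMarkovBranchingProcess {Ω : Type*} {m : MeasurableSpace Ω}
    (lam : ℝ → ℝ) (p : ℝ → PMF ℕ) (P : Measure Ω) (ℱ : Filtration ℝ≥0 m)
    (Z : ℝ≥0 → Ω → ℕ) : Prop where
  adapted : ∀ t : ℝ≥0, Measurable[ℱ t] (Z t)
  start : ∀ᵐ ω ∂P, Z 0 ω = 1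
  right_continuous : ∀ (ω : Ω) (t : ℝ≥0), ∀ᶠ u in 𝓝[>] t, Z u ω = Z t ω
  left_limits : ∀ (ω : Ω) (t : ℝ≥0), ∃ n : ℕ, ∀ᶠ u in 𝓝[<] t, Z u ω = n
  martingale : ∀ f : ℕ → ℝ, f.support.Finite →
    Martingale (fun (t : ℝ≥0) (ω : Ω) =>
      f (Z t ω) - ∫ u in (0 : ℝ)..(t : ℝ), generator lam p u f (Z u.toNNReal ω)) ℱ P

/-- The offspring generating function `h(s) = 1 - a (1 - s) + a (1 + θ)⁻¹ (1 - s)^(1 + θ)`. -/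
def offspringPgf (θ a s : ℝ) : ℝ :=
  1 - a * (1 - s) + a * (1 + θ)⁻¹ * (1 - s) ^ (1 + θ)

/-- The environment of a theta-positive branching process: a branching parameter `θ ∈ (0, 1]`,
death rates `lam t ≥ 0` with finite cumulative hazard function, mean offspring numbers
`0 ≤ a t ≤ 1 + 1 / θ`, and offspring laws `p t` with generating function
`offspringPgf θ (a t)`. Only the times `t ≥ 0` matter. -/
structure IsThetaPositiveEnvironment (θ : ℝ) (lam a : ℝ → ℝ) (p : ℝ → PMF ℕ) : Prop where
  theta_pos : 0 < θ
  theta_le_one : θ ≤ 1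
  lam_measurable : Measurable lam
  lam_nonneg : ∀ t, 0 ≤ t → 0 ≤ lam t
  lam_integrable : ∀ t, 0 ≤ t → IntervalIntegrable lam volume 0 t
  a_measurable : Measurable a
  a_nonneg : ∀ t, 0 ≤ t → 0 ≤ a t
  a_le : ∀ t, 0 ≤ t → a t ≤ 1 + 1 / θ
  p_measurable : ∀ k : ℕ, Measurable fun t => p t k
  pgf : ∀ t, 0 ≤ t → ∀ s : ℝ, 0 ≤ s → s ≤ 1 →
    HasSum (fun k : ℕ => (p t k).toReal * s ^ k) (offspringPgf θ (a t) s)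

/-- `μ_t = exp (∫_0^t (a_u - 1) dΛ_u)`, where `dΛ_u = lam u du`. -/
def mu (lam a : ℝ → ℝ) (t : ℝ) : ℝ :=
  Real.exp (∫ u in (0 : ℝ)..t, (a u - 1) * lam u)

/-- `V_{t,θ} = θ (1 + θ)⁻¹ ∫_0^t μ_u^{-θ} dΛ_u`. -/
def V (θ : ℝ) (lam a : ℝ → ℝ) (t : ℝ) : ℝ :=
  θ * (1 + θ)⁻¹ * ∫ u in (0 : ℝ)..t, mu lam a u ^ (-θ) * lam u

section Population

variable {Ω : Type*} {m : MeasurableSpace Ω} (P : Measure Ω) (Z : ℝ≥0 → Ω → ℕ)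

/-- `P (Z_t > 0)`. -/
def survivalProb (t : ℝ≥0) : ℝ := P.real {ω | 0 < Z t ω}

/-- The law of the process given `Z_t > 0`. -/
def condSurvival (t : ℝ≥0) : Measure Ω := ProbabilityTheory.cond P {ω | 0 < Z t ω}

/-- `m_t = E (Z_t | Z_t > 0)`. -/
def condMean (t : ℝ≥0) : ℝ := ∫ ω, (Z t ω : ℝ) ∂(condSurvival P Z t)

/-- `E (exp (-w Z_t / m_t) | Z_t > 0)`. -/
def condLaplace (w : ℝ) (t : ℝ≥0) : ℝ :=
  ∫ ω, Real.exp (-(w * (Z t ω : ℝ) / condMean P Z t)) ∂(condSurvival P Z t)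

/-- The critical regime: `q = lim P (Z_t = 0) = 1` and `lim m_t = ∞`. -/
def IsCritical : Prop :=
  Tendsto (fun t : ℝ≥0 => P.real {ω | Z t ω = 0}) atTop (𝓝 1) ∧
    Tendsto (condMean P Z) atTop atTop

end Population

end ThetaBranching

end

namespace ThetaBranching

/-! ### The generator on bounded and geometrically decaying functions -/

section Generator

/-! The generating function of `Z t` has a closed form, and every assertion is read off from it. Let
`φ` solve the backward equation `φ' = -λ (h(φ) - φ)` with `φ T = s`. With `x = 1 - φ` this is a
Bernoulli equation: the theta-positive form of `h` makes `y = x ^ (-θ)` satisfy the linear equation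
`y' = θ (a - 1) λ y - θ (1 + θ)⁻¹ a λ`, for which `μ ^ θ` is an integrating factor
(`exists_characteristic`).

By the branching property, the generator applied to `j ↦ φ ^ j` cancels the time derivative of `φ ^
j` (`generator_pow`), so the expectation of `φ u ^ Z u` does not depend on `u`. Comparing `u = 0`
and `u = T` gives `E (s ^ Z T) = φ 0` (`integral_pow_eq`). The martingale problem only covers
finitely supported functions, hence a truncation to `j < N`. The passage to the limit is dominated
because `φ ≤ r < 1`, and `j * r ^ (j - 1)` is bounded in `j`. No uniqueness theorem for the
Kolmogorov equations is needed.

Taking `s = 0` gives `P (Z t > 0) = D ^ (-1/θ)` with `D = survivalScale`; letting `s → 1` gives the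
mean `μ`, so `m_t = (μ ^ θ * D) ^ (1/θ)`. Thus criticality means `D → ∞` and `μ ^ θ * D → ∞`. As `D`
differs from `V` by a constant plus a multiple of `μ ^ (-θ)`, these limits are equivalent to those
for `V` (`scale_tendsto_atTop_iff`), and then `D ∼ V`. Putting `s = exp (-w / m_t)` gives the limit
law. -/

lemma natCast_mul_pow_pred_le {r : ℝ} (h0 : 0 ≤ r) (h1 : r < 1) (i : ℕ) :
    (i : ℝ) * r ^ (i - 1) ≤ 1 / (1 - r) := by
  have hpos : 0 < 1 - r := by linarith
  rcases i with _ | k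
  · simp [hpos.le]
  -- Each of the `k + 1` terms of the geometric sum is at least its last term `r ^ k`.
  have h : ((k + 1 : ℕ) : ℝ) * r ^ k ≤ ∑ j ∈ Finset.range (k + 1), r ^ j := by
    rw [← nsmul_eq_mul]
    conv_lhs => rw [← Finset.card_range (k + 1)]
    refine Finset.card_nsmul_le_sum _ _ _ fun j hj => ?_
    exact pow_le_pow_of_le_one h0 h1.le (Nat.lt_succ_iff.mp (Finset.mem_range.mp hj))
  refine h.trans ?_
  have := (summable_geometric_of_lt_one h0 h1).sum_le_tsum (Finset.range (k + 1))
    fun j _ => pow_nonneg h0 j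
  rwa [tsum_geometric_of_lt_one h0 h1, ← one_div] at this

lemma hasSum_pmf_toReal (q : PMF ℕ) : HasSum (fun k => (q k).toReal) 1 := by
  have h := ENNReal.summable_toReal (f := q) (by rw [q.tsum_coe]; simp)
  have h2 := ENNReal.tsum_toReal_eq (f := q) fun a => q.apply_ne_top a
  rw [q.tsum_coe] at h2
  simpa [← h2] using h.hasSum

lemma summable_pmf_mul (q : PMF ℕ) {g : ℕ → ℝ} {C : ℝ} (hg : ∀ k, |g k| ≤ C) :
    Summable fun k => (q k).toReal * g k := by
  refine Summable.of_norm_bounded ((hasSum_pmf_toReal q).summable.mul_right C) fun k => ?_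
  rw [Real.norm_eq_abs, abs_mul, abs_of_nonneg ENNReal.toReal_nonneg]
  exact mul_le_mul_of_nonneg_left (hg k) ENNReal.toReal_nonneg

lemma abs_tsum_pmf_mul_le (q : PMF ℕ) {g : ℕ → ℝ} {C : ℝ} (hg : ∀ k, |g k| ≤ C) :
    |∑' k, (q k).toReal * g k| ≤ C := by
  have := tsum_of_norm_bounded (f := fun k => (q k).toReal * g k)
    ((hasSum_pmf_toReal q).mul_right C) fun k => by
    rw [Real.norm_eq_abs, abs_mul, abs_of_nonneg ENNReal.toReal_nonneg]
    exact mul_le_mul_of_nonneg_left (hg k) ENNReal.toReal_nonneg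
  simpa using this

variable {lam : ℝ → ℝ} {p : ℝ → PMF ℕ} {t : ℝ} {f : ℕ → ℝ}

/-- A jump lowers the population by at most one, so both values of `f` are at most `K * r ^ (i -
1)`; this geometric decay absorbs the linear jump rate `i`. The bound is uniform in `i`, which makes
it usable for domination. -/
lemma abs_generator_le {K r : ℝ} (hr0 : 0 ≤ r) (hr1 : r < 1)
    (hf : ∀ j, |f j| ≤ K * r ^ j) (ht : 0 ≤ lam t) (i : ℕ) :
    |generator lam p t f i| ≤ lam t * (2 * K / (1 - r)) := by
  have hK : 0 ≤ K := by simpa using (abs_nonneg _).trans (hf 0)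
  have h : |∑' k : ℕ, (p t k).toReal * (f (i + k - 1) - f i)| ≤ 2 * K * r ^ (i - 1) := by
    refine abs_tsum_pmf_mul_le _ fun k => ?_
    have h1 : r ^ (i + k - 1) ≤ r ^ (i - 1) := pow_le_pow_of_le_one hr0 hr1.le (by omega)
    have h2 : r ^ i ≤ r ^ (i - 1) := pow_le_pow_of_le_one hr0 hr1.le (by omega)
    calc |f (i + k - 1) - f i| ≤ |f (i + k - 1)| + |f i| := abs_sub _ _
      _ ≤ K * r ^ (i + k - 1) + K * r ^ i := add_le_add (hf _) (hf _)
      _ ≤ K * r ^ (i - 1) + K * r ^ (i - 1) := by gcongr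
      _ = 2 * K * r ^ (i - 1) := by ring
  rw [generator, abs_mul, abs_mul, abs_of_nonneg ht, Nat.abs_cast]
  calc (i : ℝ) * lam t * |∑' k : ℕ, (p t k).toReal * (f (i + k - 1) - f i)|
      ≤ (i : ℝ) * lam t * (2 * K * r ^ (i - 1)) := by gcongr
    _ = lam t * (2 * K * ((i : ℝ) * r ^ (i - 1))) := by ring
    _ ≤ lam t * (2 * K * (1 / (1 - r))) := by
        gcongr
        exact natCast_mul_pow_pred_le hr0 hr1 i
    _ = _ := by ring

lemma generator_sum {ι : Type*} (s : Finset ι) (c : ι → ℝ) (g : ι → ℕ → ℝ)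
    (hg : ∀ n, ∃ C, ∀ j, |g n j| ≤ C) (i : ℕ) :
    generator lam p t (fun j => ∑ n ∈ s, c n * g n j) i =
      ∑ n ∈ s, c n * generator lam p t (g n) i := by
  have hsum : ∀ n, Summable fun k : ℕ => (p t k).toReal * (g n (i + k - 1) - g n i) := by
    intro n
    obtain ⟨C, hC⟩ := hg n
    exact summable_pmf_mul _ (C := C + C) fun k =>
      (abs_sub _ _).trans (add_le_add (hC _) (hC _))
  have : ∑' k : ℕ, (p t k).toReal * (∑ n ∈ s, c n * g n (i + k - 1) - ∑ n ∈ s, c n * g n i) =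
      ∑ n ∈ s, c n * ∑' k : ℕ, (p t k).toReal * (g n (i + k - 1) - g n i) := by
    simp_rw [← tsum_mul_left]
    rw [← Summable.tsum_finsetSum fun n _ => (hsum n).mul_left (c n)]
    refine tsum_congr fun k => ?_
    rw [← Finset.sum_sub_distrib, Finset.mul_sum]
    exact Finset.sum_congr rfl fun n _ => by ring
  rw [generator, this, Finset.mul_sum]
  exact Finset.sum_congr rfl fun n _ => by rw [generator]; ring

lemma tendsto_generator {g : ℕ → ℕ → ℝ} {C : ℝ} (hg : ∀ n j, |g n j| ≤ C)
    (hlim : ∀ j, Tendsto (fun n => g n j) atTop (𝓝 (f j))) (i : ℕ) :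
    Tendsto (fun n => generator lam p t (g n) i) atTop (𝓝 (generator lam p t f i)) := by
  refine Tendsto.const_mul _ ?_
  refine tendsto_tsum_of_dominated_convergence (bound := fun k => (p t k).toReal * (C + C))
    ((hasSum_pmf_toReal _).summable.mul_right _) (fun k => ?_) (Eventually.of_forall fun n k => ?_)
  · exact ((hlim _).sub (hlim _)).const_mul _
  · rw [Real.norm_eq_abs, abs_mul, abs_of_nonneg ENNReal.toReal_nonneg]
    exact mul_le_mul_of_nonneg_left ((abs_sub _ _).trans (add_le_add (hg _ _) (hg _ _)))
      ENNReal.toReal_nonneg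

/-- This is the branching property: replacing one of `i` individuals turns `s ^ i` into `s ^ (i - 1)
* s ^ k`, whose mean over `k` is `s ^ (i - 1) * h`. -/
lemma generator_pow {s h : ℝ} (hs : HasSum (fun k : ℕ => (p t k).toReal * s ^ k) h) (i : ℕ) :
    generator lam p t (fun j => s ^ j) i = (i : ℝ) * s ^ (i - 1) * (lam t * (h - s)) := by
  rcases i with _ | i
  · simp [generator]
  have : HasSum (fun k : ℕ => (p t k).toReal * (s ^ (i + 1 + k - 1) - s ^ (i + 1)))
      (s ^ i * (h - s)) := by
    have h1 := (hs.sub ((hasSum_pmf_toReal (p t)).mul_right s)).mul_left (s ^ i)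
    rw [one_mul] at h1
    refine h1.congr_fun fun k => ?_
    rw [show i + 1 + k - 1 = i + k by omega]
    ring
  rw [generator, this.tsum_eq]
  simp only [Nat.add_sub_cancel]
  ring

lemma measurable_generator (hlam : Measurable lam) (hp : ∀ k, Measurable fun t => p t k)
    {C : ℝ} (hf : ∀ j, |f j| ≤ C) (i : ℕ) : Measurable fun t => generator lam p t f i := by
  refine (hlam.const_mul _).mul ?_
  refine measurable_of_tendsto_metrizable
    (f := fun n t => ∑ k ∈ Finset.range n, (p t k).toReal * (f (i + k - 1) - f i))
    (fun n => Finset.measurable_fun_sum _ fun k _ => ((hp k).ennreal_toReal).mul_const _) ?_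
  rw [tendsto_pi_nhds]
  intro t
  exact (summable_pmf_mul (p t) (C := C + C) fun k =>
    (abs_sub _ _).trans (add_le_add (hf _) (hf _))).hasSum.tendsto_sum_nat

end Generator

/-! ### Joint measurability and the integrated forward equation -/

section Forward

variable {Ω : Type*} {m : MeasurableSpace Ω} {P : Measure Ω} {ℱ : Filtration ℝ≥0 m}
  {Z : ℝ≥0 → Ω → ℕ} {lam : ℝ → ℝ} {p : ℝ → PMF ℕ}

lemma measurable_comp_discretization (hm : ∀ t, Measurable (Z t)) (g : ℕ → ℝ≥0) {k : ℝ≥0 → ℕ}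
    (hk : Measurable k) : Measurable fun x : ℝ≥0 × Ω => Z (g (k x.1)) x.2 := by
  have h1 : Measurable fun y : ℕ × Ω => Z (g y.1) y.2 :=
    measurable_from_prod_countable_right fun j => hm (g j)
  exact h1.comp ((hk.comp measurable_fst).prodMk measurable_snd)

lemma measurable_uncurry_of_right_continuous (hm : ∀ t, Measurable (Z t))
    (hZ : ∀ (ω : Ω) (t : ℝ≥0), ∀ᶠ u in 𝓝[>] t, Z u ω = Z t ω) :
    Measurable fun x : ℝ≥0 × Ω => Z x.1 x.2 := by
  -- The grid point of mesh `1 / (n + 1)` strictly to the right of `u`: strictness lets the limit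
  -- run along `𝓝[>] u`, where right continuity applies.
  let d : ℕ → ℝ≥0 → ℝ≥0 := fun n u => ((⌊((n : ℝ≥0) + 1) * u⌋₊ : ℝ≥0) + 1) / ((n : ℝ≥0) + 1)
  have hd_gt : ∀ n u, u < d n u := fun n u => by
    rw [lt_div_iff₀ (by positivity), mul_comm]
    exact Nat.lt_floor_add_one _
  have hd_le : ∀ n u, d n u ≤ u + 1 / ((n : ℝ≥0) + 1) := fun n u => by
    have : (⌊((n : ℝ≥0) + 1) * u⌋₊ : ℝ≥0) ≤ ((n : ℝ≥0) + 1) * u := Nat.floor_le (by positivity)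
    calc d n u ≤ (((n : ℝ≥0) + 1) * u + 1) / ((n : ℝ≥0) + 1) := by dsimp only [d]; gcongr
      _ = u + 1 / ((n : ℝ≥0) + 1) := by field_simp
  have hd_lim : ∀ u, Tendsto (fun n => d n u) atTop (𝓝[>] u) := fun u => by
    refine tendsto_nhdsWithin_iff.mpr ⟨?_, Eventually.of_forall fun n => hd_gt n u⟩
    refine tendsto_of_tendsto_of_tendsto_of_le_of_le tendsto_const_nhds ?_
      (fun n => (hd_gt n u).le) (fun n => hd_le n u)
    simpa using (tendsto_const_nhds (x := u)).add
      (tendsto_one_div_add_atTop_nhds_zero_nat (𝕜 := ℝ≥0))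
  refine measurable_of_tendsto_metrizable (f := fun n (x : ℝ≥0 × Ω) => Z (d n x.1) x.2)
    (fun n => ?_) ?_
  · exact measurable_comp_discretization hm (fun k => ((k : ℝ≥0) + 1) / ((n : ℝ≥0) + 1))
      (k := fun u => ⌊((n : ℝ≥0) + 1) * u⌋₊)
      (Nat.measurable_floor.comp (measurable_id.const_mul _))
  · rw [tendsto_pi_nhds]
    intro x
    exact tendsto_const_nhds.congr' (((hd_lim x.1).eventually (hZ x.2 x.1)).mono fun n hn => hn.symm)

lemma IsMarkovBranchingProcess.measurable (hZ : IsMarkovBranchingProcess lam p P ℱ Z) (t : ℝ≥0) :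
    Measurable (Z t) := (hZ.adapted t).mono (ℱ.le t) le_rfl


lemma IsMarkovBranchingProcess.measurable_generator (hZ : IsMarkovBranchingProcess lam p P ℱ Z)
    (hlam : Measurable lam) (hp : ∀ k, Measurable fun t => p t k) {f : ℕ → ℝ} {C : ℝ}
    (hf : ∀ j, |f j| ≤ C) :
    Measurable fun x : ℝ × Ω => generator lam p x.1 f (Z x.1.toNNReal x.2) := by
  have h1 : Measurable fun y : ℝ × ℕ => generator lam p y.1 f y.2 :=
    measurable_from_prod_countable_left fun i =>
      ThetaBranching.measurable_generator hlam hp hf i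
  have h2 : Measurable fun x : ℝ × Ω => Z x.1.toNNReal x.2 :=
    (measurable_uncurry_of_right_continuous hZ.measurable hZ.right_continuous).comp
      ((measurable_real_toNNReal.comp measurable_fst).prodMk measurable_snd)
  exact h1.comp (measurable_fst.prodMk h2)

/-- The integrated forward equation for finitely supported test functions. -/
lemma IsMarkovBranchingProcess.integral_eq [IsProbabilityMeasure P]
    (hZ : IsMarkovBranchingProcess lam p P ℱ Z)
    (hlam : Measurable lam) (hlam0 : ∀ t, 0 ≤ t → 0 ≤ lam t)
    (hint : ∀ t, 0 ≤ t → IntervalIntegrable lam volume 0 t)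
    (hp : ∀ k, Measurable fun t => p t k) {f : ℕ → ℝ} (hfs : f.support.Finite)
    {K r : ℝ} (hr0 : 0 ≤ r) (hr1 : r < 1) (hf : ∀ j, |f j| ≤ K * r ^ j) {t : ℝ} (ht : 0 ≤ t) :
    IntervalIntegrable (fun u => ∫ ω, generator lam p u f (Z u.toNNReal ω) ∂P) volume 0 t ∧
    ∫ ω, f (Z t.toNNReal ω) ∂P =
      f 1 + ∫ u in (0 : ℝ)..t, ∫ ω, generator lam p u f (Z u.toNNReal ω) ∂P := by
  have hK : 0 ≤ K := by simpa using (abs_nonneg _).trans (hf 0)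
  have hfb : ∀ j, |f j| ≤ K := fun j =>
    (hf j).trans (mul_le_of_le_one_right hK (pow_le_one₀ hr0 hr1.le))
  have hmeas := hZ.measurable_generator hlam hp hfb
  have hlam_int : Integrable lam (volume.restrict (Set.Ioc 0 t)) :=
    (intervalIntegrable_iff_integrableOn_Ioc_of_le ht).mp (hint t ht)
  have hprod : Integrable (fun x : ℝ × Ω => generator lam p x.1 f (Z x.1.toNNReal x.2))
      ((volume.restrict (Set.Ioc 0 t)).prod P) := by
    refine Integrable.mono' ((hlam_int.mul_const (2 * K / (1 - r))).comp_fst P)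
      hmeas.aestronglyMeasurable ?_
    have h0 : ∀ᵐ u ∂(volume.restrict (Set.Ioc (0 : ℝ) t)), 0 ≤ lam u :=
      (ae_restrict_mem measurableSet_Ioc).mono fun u hu => hlam0 u hu.1.le
    have h1 : ∀ᵐ x ∂((volume.restrict (Set.Ioc (0 : ℝ) t)).prod P), 0 ≤ lam x.1 :=
      Measure.quasiMeasurePreserving_fst.ae h0
    filter_upwards [h1] with x hx
    exact abs_generator_le hr0 hr1 hf hx _
  refine ⟨(intervalIntegrable_iff_integrableOn_Ioc_of_le ht).mpr hprod.integral_prod_left, ?_⟩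
  have hM := hZ.martingale f hfs
  have hfZ : ∀ s : ℝ≥0, Integrable (fun ω => f (Z s ω)) P := fun s =>
    Integrable.of_bound ((measurable_from_nat (f := f)).comp (hZ.measurable s)).aestronglyMeasurable K
      (Eventually.of_forall fun ω => hfb _)
  have h0 : ∫ ω, f (Z 0 ω) ∂P = f 1 := by
    rw [integral_congr_ae (g := fun _ => f 1) (hZ.start.mono fun ω hω => by simp [hω])]
    simp
  -- The martingale has the same mean at times `0` and `t`; Fubini below then exchanges expectation
  -- and time integral.
  have hE := hM.setIntegral_eq (zero_le (a := t.toNNReal)) MeasurableSet.univ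
  simp only [setIntegral_univ, NNReal.coe_zero, intervalIntegral.integral_same, sub_zero, h0,
    Real.coe_toNNReal t ht] at hE
  have hI : Integrable (fun ω => ∫ u in (0 : ℝ)..t, generator lam p u f (Z u.toNNReal ω)) P := by
    simp_rw [intervalIntegral.integral_of_le ht]
    exact hprod.integral_prod_right
  rw [integral_sub (hfZ _) hI] at hE
  have hswap : ∫ ω, (∫ u in (0 : ℝ)..t, generator lam p u f (Z u.toNNReal ω)) ∂P =
      ∫ u in (0 : ℝ)..t, ∫ ω, generator lam p u f (Z u.toNNReal ω) ∂P := by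
    simp_rw [intervalIntegral.integral_of_le ht]
    exact (integral_integral_swap
      (f := fun (u : ℝ) (ω : Ω) => generator lam p u f (Z u.toNNReal ω)) hprod).symm
  linarith

/-- On extinction the integrand is the constant `f 0`, so the integral over survival is the full
integral minus that contribution. -/
lemma integral_condSurvival (hZ : IsMarkovBranchingProcess lam p P ℱ Z) (t : ℝ≥0) {f : ℕ → ℝ}
    (hf : Integrable (fun ω => f (Z t ω)) P) :
    ∫ ω, f (Z t ω) ∂(condSurvival P Z t) =
      (survivalProb P Z t)⁻¹ * (∫ ω, f (Z t ω) ∂P - f 0 * P.real {ω | Z t ω = 0}) := by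
  have hm : MeasurableSet {ω | Z t ω = 0} := hZ.measurable t (measurableSet_singleton 0)
  have hc : {ω | 0 < Z t ω} = {ω | Z t ω = 0}ᶜ := by
    ext ω
    simp [Nat.pos_iff_ne_zero]
  have h0 : ∫ ω in {ω | Z t ω = 0}, f (Z t ω) ∂P = f 0 * P.real {ω | Z t ω = 0} := by
    rw [setIntegral_congr_fun hm (g := fun _ => f 0) fun ω hω => by
      simp only [Set.mem_ofPred_eq] at hω; simp only [hω]]
    rw [setIntegral_const, smul_eq_mul, mul_comm]
  rw [condSurvival, ProbabilityTheory.cond, integral_smul_measure, survivalProb, ← h0,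
    ← integral_add_compl hm hf, add_sub_cancel_left, ← hc, ENNReal.toReal_inv, smul_eq_mul]
  rfl

end Forward

/-! ### Calculus of absolutely continuous functions -/

section AbsolutelyContinuous

lemma absolutelyContinuousOnInterval_of_dist_le {f g : ℝ → ℝ} {a b C : ℝ}
    (hf : AbsolutelyContinuousOnInterval f a b)
    (h : ∀ x ∈ Set.uIcc a b, ∀ y ∈ Set.uIcc a b, dist (g x) (g y) ≤ C * dist (f x) (f y)) :
    AbsolutelyContinuousOnInterval g a b := by
  rw [absolutelyContinuousOnInterval_iff] at hf ⊢
  intro ε hε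
  -- `|C| + 1` keeps the denominator positive whatever `C` is; later uses with `C = 0` yield
  -- constant functions.
  obtain ⟨δ, hδ, H⟩ := hf (ε / (|C| + 1)) (by positivity)
  refine ⟨δ, hδ, fun E hE hlen => ?_⟩
  have h1 := H E hE hlen
  rw [lt_div_iff₀ (by positivity)] at h1
  refine lt_of_le_of_lt ?_ h1
  rw [Finset.sum_mul]
  refine Finset.sum_le_sum fun i hi => ?_
  have hmem := hE.1 i hi
  refine (h _ hmem.1 _ hmem.2).trans ?_
  rw [mul_comm]
  gcongr
  linarith [le_abs_self C]

lemma absolutelyContinuousOnInterval_comp {f g g' : ℝ → ℝ} {a b C : ℝ} {S : Set ℝ}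
    (hf : AbsolutelyContinuousOnInterval f a b) (hS : Convex ℝ S)
    (hmaps : ∀ x ∈ Set.uIcc a b, f x ∈ S)
    (hg : ∀ x ∈ S, HasDerivAt g (g' x) x) (hbound : ∀ x ∈ S, |g' x| ≤ C) :
    AbsolutelyContinuousOnInterval (fun x => g (f x)) a b := by
  refine absolutelyContinuousOnInterval_of_dist_le (C := C) hf fun x hx y hy => ?_
  rw [dist_comm, dist_comm (f x), Real.dist_eq, Real.dist_eq]
  exact hS.norm_image_sub_le_of_norm_hasDerivWithin_le
    (fun z hz => (hg z hz).hasDerivWithinAt) hbound (hmaps x hx) (hmaps y hy)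

lemma absolutelyContinuousOnInterval_exp_mul {f : ℝ → ℝ} {a b : ℝ} (k : ℝ)
    (hf : AbsolutelyContinuousOnInterval f a b) :
    AbsolutelyContinuousOnInterval (fun x => Real.exp (k * f x)) a b := by
  obtain ⟨R, hR⟩ := hf.exists_bound
  refine absolutelyContinuousOnInterval_comp (g := fun z => Real.exp (k * z))
    (g' := fun z => Real.exp (k * z) * k) (S := Set.Icc (-R) R) (C := Real.exp (|k| * R) * |k|)
    hf (convex_Icc _ _) (fun x hx => abs_le.mp (hR x hx)) (fun z _ => ?_) (fun z hz => ?_)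
  · simpa using ((hasDerivAt_id z).const_mul k).exp
  · have h : k * z ≤ |k| * R :=
      (le_abs_self _).trans ((abs_mul k z).le.trans
        (mul_le_mul_of_nonneg_left (abs_le.mpr hz) (abs_nonneg k)))
    rw [abs_mul, Real.abs_exp]
    exact mul_le_mul_of_nonneg_right (Real.exp_le_exp.mpr h) (abs_nonneg k)

lemma absolutelyContinuousOnInterval_pow {f : ℝ → ℝ} {a b : ℝ} (n : ℕ)
    (hf : AbsolutelyContinuousOnInterval f a b) :
    AbsolutelyContinuousOnInterval (fun x => f x ^ n) a b := by
  induction n with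
  | zero =>
    refine absolutelyContinuousOnInterval_of_dist_le (C := 0) hf fun x _ y _ => ?_
    simp
  | succ n ih => simpa only [pow_succ] using ih.fun_mul hf

lemma absolutelyContinuousOnInterval_sum {ι : Type*} (s : Finset ι) {f : ι → ℝ → ℝ} {a b : ℝ}
    (hf : ∀ i ∈ s, AbsolutelyContinuousOnInterval (f i) a b) :
    AbsolutelyContinuousOnInterval (fun x => ∑ i ∈ s, f i x) a b := by
  classical
  induction s using Finset.induction_on with
  | empty =>
    have : AbsolutelyContinuousOnInterval (fun x : ℝ => x) a b :=
      (LipschitzWith.id.lipschitzOnWith (s := Set.uIcc a b)).absolutelyContinuousOnInterval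
    refine absolutelyContinuousOnInterval_of_dist_le (C := 0) this fun x _ y _ => ?_
    simp
  | insert i s hi ih =>
    simp only [Finset.sum_insert hi]
    exact (hf i (by simp)).fun_add (ih fun j hj => hf j (by simp [hj]))

/-- A function that equals an indefinite integral on `[0, T]` is absolutely continuous there and
has the integrand as its derivative almost everywhere. -/
lemma absolutelyContinuousOnInterval_of_eq_integral {F g : ℝ → ℝ} {c T : ℝ} (hT : 0 ≤ T)
    (hg : IntervalIntegrable g volume 0 T)
    (hF : ∀ t ∈ Set.Icc 0 T, F t = c + ∫ u in (0 : ℝ)..t, g u) :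
    AbsolutelyContinuousOnInterval F 0 T ∧
      ∀ᵐ u, u ∈ Set.Ioo 0 T → HasDerivAt F (g u) u := by
  constructor
  · refine absolutelyContinuousOnInterval_of_dist_le (C := 1)
      (hg.absolutelyContinuousOnInterval_intervalIntegral (c := 0) (by simp)) fun x hx y hy => ?_
    rw [Set.uIcc_of_le hT] at hx hy
    rw [hF x hx, hF y hy, dist_add_left, one_mul]
  · filter_upwards [hg.ae_hasDerivAt_integral] with u hu hmem
    have h1 := (hu (by rw [Set.uIcc_of_le hT]; exact Set.Ioo_subset_Icc_self hmem) 0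
      (by simp)).const_add c
    refine h1.congr_of_eventuallyEq ?_
    filter_upwards [Ioo_mem_nhds hmem.1 hmem.2] with v hv
    exact hF v (Set.Ioo_subset_Icc_self hv)

end AbsolutelyContinuous

/-! ### The backward characteristic in closed form -/

section Characteristic

variable {θ : ℝ} {lam a : ℝ → ℝ} {p : ℝ → PMF ℕ}

lemma mu_pos (t : ℝ) : 0 < mu lam a t := Real.exp_pos _

lemma mu_rpow (k t : ℝ) :
    mu lam a t ^ k = Real.exp (k * ∫ u in (0 : ℝ)..t, (a u - 1) * lam u) := by
  rw [mu, ← Real.exp_mul, mul_comm]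

lemma IsThetaPositiveEnvironment.intervalIntegrable_mul
    (hEnv : IsThetaPositiveEnvironment θ lam a p) {T : ℝ} (hT : 0 ≤ T) {g : ℝ → ℝ}
    (hg : Measurable g) {C : ℝ} (hC : ∀ t, 0 ≤ t → |g t| ≤ C) :
    IntervalIntegrable (fun u => g u * lam u) volume 0 T := by
  have h := hEnv.lam_integrable T hT
  rw [intervalIntegrable_iff_integrableOn_Ioc_of_le hT] at h ⊢
  refine Integrable.mono' (h.const_mul C) (hg.mul hEnv.lam_measurable).aestronglyMeasurable ?_
  filter_upwards [ae_restrict_mem measurableSet_Ioc] with u hu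
  rw [Real.norm_eq_abs, abs_mul, abs_of_nonneg (hEnv.lam_nonneg u hu.1.le)]
  exact mul_le_mul_of_nonneg_right (hC u hu.1.le) (hEnv.lam_nonneg u hu.1.le)

lemma IsThetaPositiveEnvironment.abs_sub_one_le
    (hEnv : IsThetaPositiveEnvironment θ lam a p) (t : ℝ) (ht : 0 ≤ t) :
    |a t - 1| ≤ 1 + 1 / θ := by
  have h1 := hEnv.a_nonneg t ht
  have h2 := hEnv.a_le t ht
  have h3 : 0 < 1 / θ := one_div_pos.mpr hEnv.theta_pos
  rw [abs_le]
  constructor <;> linarith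

lemma IsThetaPositiveEnvironment.mu_rpow_ac
    (hEnv : IsThetaPositiveEnvironment θ lam a p) {T : ℝ} (hT : 0 ≤ T) (k : ℝ) :
    AbsolutelyContinuousOnInterval (fun t => mu lam a t ^ k) 0 T ∧
      ∀ᵐ u, u ∈ Set.Ioo 0 T →
        HasDerivAt (fun t => mu lam a t ^ k) (mu lam a u ^ k * (k * ((a u - 1) * lam u))) u := by
  have hI := hEnv.intervalIntegrable_mul hT (hEnv.a_measurable.sub_const 1) hEnv.abs_sub_one_le
  obtain ⟨h1, h2⟩ := absolutelyContinuousOnInterval_of_eq_integral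
    (F := fun t => ∫ u in (0 : ℝ)..t, (a u - 1) * lam u) (c := 0) hT hI (fun t _ => by simp)
  simp only [mu_rpow]
  refine ⟨absolutelyContinuousOnInterval_exp_mul k h1, ?_⟩
  filter_upwards [h2] with u hu hmem
  exact ((hu hmem).const_mul k).exp

lemma IsThetaPositiveEnvironment.intervalIntegrable_mul_mu
    (hEnv : IsThetaPositiveEnvironment θ lam a p) {T : ℝ} (hT : 0 ≤ T) {g : ℝ → ℝ}
    (hg : Measurable g) {C : ℝ} (hC : ∀ t, 0 ≤ t → |g t| ≤ C) (k : ℝ) :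
    IntervalIntegrable (fun u => g u * lam u * mu lam a u ^ k) volume 0 T :=
  (hEnv.intervalIntegrable_mul hT hg hC).mul_continuousOn (hEnv.mu_rpow_ac hT k).1.continuousOn

/-- The integrand is `-1/θ` times the almost everywhere derivative of the absolutely continuous
function `μ ^ (-θ)`. -/
lemma IsThetaPositiveEnvironment.integral_sub_one_mul_mu
    (hEnv : IsThetaPositiveEnvironment θ lam a p) {T : ℝ} (hT : 0 ≤ T) :
    ∫ u in (0 : ℝ)..T, (a u - 1) * lam u * mu lam a u ^ (-θ) =
      (1 - mu lam a T ^ (-θ)) / θ := by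
  obtain ⟨h1, h2⟩ := hEnv.mu_rpow_ac hT (-θ)
  have h3 := h1.integral_deriv_eq_sub
  have h4 : ∫ u in (0 : ℝ)..T, deriv (fun t => mu lam a t ^ (-θ)) u =
      ∫ u in (0 : ℝ)..T, (-θ) * ((a u - 1) * lam u * mu lam a u ^ (-θ)) := by
    refine intervalIntegral.integral_congr_ae ?_
    have hne : ∀ᵐ u : ℝ, u ≠ T := by simp [ae_iff, measure_singleton]
    filter_upwards [h2, hne] with u hu hu' hmem
    rw [Set.uIoc_of_le hT] at hmem
    rw [(hu ⟨hmem.1, lt_of_le_of_ne hmem.2 hu'⟩).deriv]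
    ring
  rw [h4, intervalIntegral.integral_const_mul] at h3
  have h0 : mu lam a 0 ^ (-θ) = 1 := by simp [mu]
  rw [h0] at h3
  have := hEnv.theta_pos
  rw [eq_div_iff this.ne']
  linarith

/-- Splitting `a = (a - 1) + 1` separates an exact derivative from the integrand of `V`; this is how
`V` enters the value of the characteristic at time `0`. -/
lemma IsThetaPositiveEnvironment.integral_a_mul_mu
    (hEnv : IsThetaPositiveEnvironment θ lam a p) {T : ℝ} (hT : 0 ≤ T) :
    θ * (1 + θ)⁻¹ * ∫ u in (0 : ℝ)..T, a u * lam u * mu lam a u ^ (-θ) =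
      V θ lam a T + (1 - mu lam a T ^ (-θ)) / (1 + θ) := by
  have hθ := hEnv.theta_pos
  have h1 := hEnv.integral_sub_one_mul_mu hT
  have hI1 := hEnv.intervalIntegrable_mul_mu hT (hEnv.a_measurable.sub_const 1)
    hEnv.abs_sub_one_le (-θ)
  have hI2 := hEnv.intervalIntegrable_mul_mu hT (measurable_const (a := (1 : ℝ)))
    (C := 1) (fun _ _ => by simp) (-θ)
  have h2 : ∫ u in (0 : ℝ)..T, a u * lam u * mu lam a u ^ (-θ) =
      (1 - mu lam a T ^ (-θ)) / θ + ∫ u in (0 : ℝ)..T, mu lam a u ^ (-θ) * lam u := by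
    rw [← h1]
    have : ∫ u in (0 : ℝ)..T, mu lam a u ^ (-θ) * lam u =
        ∫ u in (0 : ℝ)..T, 1 * lam u * mu lam a u ^ (-θ) := by
      congr 1; ext u; ring
    rw [this, ← intervalIntegral.integral_add hI1 hI2]
    congr 1; ext u; ring
  rw [h2, V]
  field_simp
  ring

/-- The backward characteristic through `(T, s)`: along it `P`-expectations of
`φ u ^ Z u` are constant. -/
lemma IsThetaPositiveEnvironment.exists_characteristic
    (hEnv : IsThetaPositiveEnvironment θ lam a p) {T : ℝ} (hT : 0 ≤ T) {s : ℝ} (hs0 : 0 ≤ s)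
    (hs1 : s < 1) :
    ∃ (φ : ℝ → ℝ) (r : ℝ), r < 1 ∧ AbsolutelyContinuousOnInterval φ 0 T ∧
      (∀ u ∈ Set.Icc 0 T, 0 ≤ φ u ∧ φ u ≤ r) ∧ φ T = s ∧
      φ 0 = 1 - (mu lam a T ^ (-θ) * (1 - s) ^ (-θ) +
        (V θ lam a T + (1 - mu lam a T ^ (-θ)) / (1 + θ))) ^ (-(1 / θ)) ∧
      ∀ᵐ u, u ∈ Set.Ioo 0 T →
        HasDerivAt φ (-(lam u * (offspringPgf θ (a u) (φ u) - φ u))) u := by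
  have hθ := hEnv.theta_pos
  have hs : 0 < 1 - s := by linarith
  set E : ℝ → ℝ := fun t => mu lam a t ^ (-θ) with hE
  set c : ℝ := θ * (1 + θ)⁻¹ with hc
  have hEpos : ∀ t, 0 < E t := fun t => Real.rpow_pos_of_pos (mu_pos t) _
  have ha_abs : ∀ t, 0 ≤ t → |a t| ≤ 1 + 1 / θ := fun t ht => by
    rw [abs_of_nonneg (hEnv.a_nonneg t ht)]; exact hEnv.a_le t ht
  have hIa : ∀ t, 0 ≤ t → IntervalIntegrable (fun u => a u * lam u * E u) volume 0 t :=
    fun t ht => hEnv.intervalIntegrable_mul_mu ht hEnv.a_measurable ha_abs (-θ)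
  have hIa1 : ∀ t, 0 ≤ t → IntervalIntegrable (fun u => (a u - 1) * lam u * E u) volume 0 t :=
    fun t ht => hEnv.intervalIntegrable_mul_mu ht (hEnv.a_measurable.sub_const 1)
      hEnv.abs_sub_one_le (-θ)
  set wT : ℝ := E T * (1 - s) ^ (-θ) with hwT
  set A : ℝ → ℝ := fun t => ∫ u in (0 : ℝ)..t, a u * lam u * E u with hA
  -- `w = μ ^ (-θ) * y` satisfies `w' = -c a λ μ ^ (-θ)`, so it is integrated backwards from its
  -- terminal value `wT`.
  set w : ℝ → ℝ := fun t => wT + c * (A T - A t) with hw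
  set y : ℝ → ℝ := fun t => mu lam a t ^ θ * w t with hy
  -- Equivalent to `1 ≤ y`, that is `0 ≤ φ`. It holds at `T`, and going backwards `w` grows at least
  -- as fast as `E`, because `θ (a - 1) ≤ c a` is exactly `a ≤ 1 + 1 / θ`.
  have hwE : ∀ u ∈ Set.Icc 0 T, E u ≤ w u := by
    intro u hu
    have h1 : E T ≤ wT := by
      refine le_mul_of_one_le_right (hEpos T).le ?_
      exact Real.one_le_rpow_of_pos_of_le_one_of_nonpos hs (by linarith) (by linarith)
    have h2 : A T - A u = ∫ v in u..T, a v * lam v * E v :=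
      intervalIntegral.integral_interval_sub_left (hIa T hT) (hIa u hu.1)
    have h3 : E u - E T = θ * ∫ v in u..T, (a v - 1) * lam v * E v := by
      rw [← intervalIntegral.integral_interval_sub_left (hIa1 T hT) (hIa1 u hu.1),
        hEnv.integral_sub_one_mul_mu hT, hEnv.integral_sub_one_mul_mu hu.1]
      field_simp
      ring
    have hsub : Set.uIcc u T ⊆ Set.uIcc 0 T := by
      rw [Set.uIcc_of_le hu.2, Set.uIcc_of_le hT]; exact Set.Icc_subset_Icc_left hu.1
    have h4 : θ * (∫ v in u..T, (a v - 1) * lam v * E v) ≤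
        c * ∫ v in u..T, a v * lam v * E v := by
      rw [← intervalIntegral.integral_const_mul, ← intervalIntegral.integral_const_mul]
      refine intervalIntegral.integral_mono_on hu.2 (((hIa1 T hT).mono_set hsub).const_mul _)
        (((hIa T hT).mono_set hsub).const_mul _) fun v hv => ?_
      have hv0 : 0 ≤ v := hu.1.trans hv.1
      have hle := hEnv.a_le v hv0
      have h5 : θ * (a v - 1) ≤ c * a v := by
        have h6 : a v * θ ≤ 1 + θ := by
          calc a v * θ ≤ (1 + 1 / θ) * θ := by gcongr
            _ = 1 + θ := by field_simp; ring
        have h7 : c * a v - θ * (a v - 1) = θ * (1 + θ)⁻¹ * (1 + θ - a v * θ) := by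
          rw [hc]; field_simp; ring
        have h8 : 0 ≤ θ * (1 + θ)⁻¹ * (1 + θ - a v * θ) :=
          mul_nonneg (by positivity) (by linarith)
        linarith
      have h9 : 0 ≤ lam v * E v := mul_nonneg (hEnv.lam_nonneg v hv0) (hEpos v).le
      calc θ * ((a v - 1) * lam v * E v) = θ * (a v - 1) * (lam v * E v) := by ring
        _ ≤ c * a v * (lam v * E v) := by gcongr
        _ = _ := by ring
    simp only [hw]
    rw [h2]
    linarith
  have hyone : ∀ u ∈ Set.Icc 0 T, 1 ≤ y u := by
    intro u hu
    have h1 : mu lam a u ^ θ * E u = 1 := by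
      rw [hE]
      simp only
      rw [← Real.rpow_add (mu_pos u), add_neg_cancel, Real.rpow_zero]
    calc 1 = mu lam a u ^ θ * E u := h1.symm
      _ ≤ y u := mul_le_mul_of_nonneg_left (hwE u hu) (Real.rpow_nonneg (mu_pos u).le _)
  obtain ⟨hwac, hwd⟩ := absolutelyContinuousOnInterval_of_eq_integral
    (F := w) (c := wT + c * A T) hT (((hIa T hT).const_mul c).neg) (fun t _ => by
      simp only [hw, hA, Pi.neg_apply, intervalIntegral.integral_neg,
        intervalIntegral.integral_const_mul]
      ring)
  obtain ⟨hmac, hmd⟩ := hEnv.mu_rpow_ac hT θ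
  have hyac : AbsolutelyContinuousOnInterval y 0 T := hmac.fun_mul hwac
  -- An upper bound for `y` keeps `φ` uniformly below `r = 1 - B ^ (-(1 / θ)) < 1`, as the geometric
  -- domination requires.
  obtain ⟨B, hB⟩ := hyac.exists_bound
  rw [Set.uIcc_of_le hT] at hB
  have hB1 : 1 ≤ B := by
    have h0 : (0 : ℝ) ∈ Set.Icc 0 T := ⟨le_rfl, hT⟩
    exact (hyone 0 h0).trans ((le_abs_self _).trans (hB 0 h0))
  have hBpos : 0 < B ^ (-(1 / θ)) := Real.rpow_pos_of_pos (by linarith) _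
  have hneg : -(1 / θ) ≤ 0 := by have := one_div_pos.mpr hθ; linarith
  have hxac : AbsolutelyContinuousOnInterval (fun t => y t ^ (-(1 / θ))) 0 T := by
    refine absolutelyContinuousOnInterval_comp (g := fun z => z ^ (-(1 / θ)))
      (g' := fun z => -(1 / θ) * z ^ (-(1 / θ) - 1)) (S := Set.Ici 1) (C := 1 / θ) hyac
      (convex_Ici 1) (fun x hx => hyone x (by rwa [Set.uIcc_of_le hT] at hx)) (fun z hz => ?_)
      (fun z hz => ?_)
    · exact Real.hasDerivAt_rpow_const (Or.inl (by linarith [Set.mem_Ici.mp hz]))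
    · have hz1 : (1 : ℝ) ≤ z := hz
      rw [abs_mul, abs_neg, abs_of_pos (one_div_pos.mpr hθ),
        abs_of_nonneg (Real.rpow_nonneg (by linarith) _)]
      exact mul_le_of_le_one_right (one_div_pos.mpr hθ).le
        (Real.rpow_le_one_of_one_le_of_nonpos hz1 (by linarith))
  have hone : AbsolutelyContinuousOnInterval (fun _ : ℝ => (1 : ℝ)) 0 T :=
    absolutelyContinuousOnInterval_of_dist_le (C := 0) hyac fun x _ z _ => by simp
  refine ⟨fun t => 1 - y t ^ (-(1 / θ)), 1 - B ^ (-(1 / θ)), by linarith, hone.fun_sub hxac,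
    fun u hu => ⟨?_, ?_⟩, ?_, ?_, ?_⟩
  · linarith [Real.rpow_le_one_of_one_le_of_nonpos (hyone u hu) hneg]
  · have h1 := hyone u hu
    have h2 : y u ≤ B := (le_abs_self _).trans (hB u hu)
    linarith [Real.rpow_le_rpow_of_nonpos (by linarith : 0 < y u) h2 hneg]
  · have h1 : y T = (1 - s) ^ (-θ) := by
      simp only [hy, hw, hwT, hE, sub_self, mul_zero, add_zero]
      rw [← mul_assoc, ← Real.rpow_add (mu_pos T), add_neg_cancel, Real.rpow_zero, one_mul]
    simp only [h1]
    rw [← Real.rpow_mul hs.le, show -θ * -(1 / θ) = 1 by field_simp, Real.rpow_one]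
    ring
  · have h1 : y 0 = wT + c * A T := by
      simp [hy, hw, hA, mu]
    simp only [h1]
    rw [hc, hEnv.integral_a_mul_mu hT]
  · filter_upwards [hwd, hmd] with u hu1 hu2 hmem
    have hmem' := Set.Ioo_subset_Icc_self hmem
    have h1 := (hu2 hmem).mul (hu1 hmem)
    have hy1 : 1 ≤ y u := hyone u hmem'
    have hypos : 0 < y u := by linarith
    have h2 := (h1.rpow_const (p := -(1 / θ)) (Or.inl (by
      have := hypos.ne'
      simpa [hy] using this))).const_sub 1
    refine h2.congr_deriv ?_
    have hmE : mu lam a u ^ θ * E u = 1 := by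
      rw [hE]
      simp only
      rw [← Real.rpow_add (mu_pos u), add_neg_cancel, Real.rpow_zero]
    have hyu : mu lam a u ^ θ * w u = y u := rfl
    simp only [Pi.mul_apply, Pi.neg_apply, offspringPgf, hyu]
    set x := y u ^ (-(1 / θ)) with hx
    have hp1 : y u ^ (-(1 / θ) - 1) * y u = x := by
      rw [Real.rpow_sub_one hypos.ne', div_mul_cancel₀ _ hypos.ne']
    have hp2 : (1 - (1 - x)) ^ (1 + θ) = y u ^ (-(1 / θ) - 1) := by
      rw [sub_sub_cancel, hx, ← Real.rpow_mul hypos.le]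
      congr 1
      field_simp
      ring
    rw [hp2]
    have hd : mu lam a u ^ θ * (θ * ((a u - 1) * lam u)) * w u +
        mu lam a u ^ θ * -(c * (a u * lam u * E u)) =
        θ * ((a u - 1) * lam u) * y u - c * (a u * lam u) := by
      rw [← hyu]
      linear_combination (-(c * (a u * lam u))) * hmE
    rw [hd, ← hp1, hc]
    field_simp
    ring

end Characteristic

/-! ### Constancy along the characteristic and the generating function -/

section GeneratingFunction

variable {Ω : Type*} {m : MeasurableSpace Ω} {P : Measure Ω} [IsProbabilityMeasure P]
  {ℱ : Filtration ℝ≥0 m} {Z : ℝ≥0 → Ω → ℕ} {θ : ℝ} {lam a : ℝ → ℝ} {p : ℝ → PMF ℕ}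

lemma sum_range_mul_ite (N : ℕ) (c : ℕ → ℝ) (j : ℕ) :
    ∑ n ∈ Finset.range N, c n * (if j = n then 1 else 0) = if j < N then c j else 0 := by
  simp

lemma tendsto_ite_lt (c : ℕ → ℝ) (j : ℕ) :
    Tendsto (fun N => if j < N then c j else 0) atTop (𝓝 (c j)) := by
  refine tendsto_const_nhds.congr' ?_
  filter_upwards [eventually_gt_atTop j] with N hN
  rw [if_pos hN]

lemma tendsto_integral_comp_nat {X : Ω → ℕ} (hX : Measurable X) {g : ℕ → ℕ → ℝ} {f : ℕ → ℝ}
    {C : ℝ} (hg : ∀ n j, |g n j| ≤ C) (hlim : ∀ j, Tendsto (fun n => g n j) atTop (𝓝 (f j))) :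
    Tendsto (fun n => ∫ ω, g n (X ω) ∂P) atTop (𝓝 (∫ ω, f (X ω) ∂P)) :=
  tendsto_integral_of_dominated_convergence (fun _ => C)
    (fun _ => (measurable_from_nat.comp hX).aestronglyMeasurable) (integrable_const _)
    (fun n => Eventually.of_forall fun _ => hg n _) (Eventually.of_forall fun _ => hlim _)

lemma integrable_comp_nat {X : Ω → ℕ} (hX : Measurable X) {f : ℕ → ℝ} {C : ℝ}
    (hf : ∀ j, |f j| ≤ C) : Integrable (fun ω => f (X ω)) P :=
  Integrable.of_bound (measurable_from_nat.comp hX).aestronglyMeasurable C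
    (Eventually.of_forall fun _ => hf _)

/-- The generating function of the theta-positive branching process. -/
lemma integral_pow_eq (hEnv : IsThetaPositiveEnvironment θ lam a p)
    (hZ : IsMarkovBranchingProcess lam p P ℱ Z) (t : ℝ≥0) {s : ℝ} (hs0 : 0 ≤ s) (hs1 : s < 1) :
    ∫ ω, s ^ Z t ω ∂P = 1 - (mu lam a t ^ (-θ) * (1 - s) ^ (-θ) +
        (V θ lam a t + (1 - mu lam a t ^ (-θ)) / (1 + θ))) ^ (-(1 / θ)) := by
  obtain ⟨T, hTdef⟩ : ∃ T : ℝ, T = (t : ℝ) := ⟨_, rfl⟩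
  have hT : 0 ≤ T := hTdef ▸ t.2
  rw [← hTdef]
  obtain ⟨φ, r, hr1, hφac, hφr, hφT, hφ0, hφd⟩ := hEnv.exists_characteristic hT hs0 hs1
  rw [← hφ0]
  have hr0 : 0 ≤ r := (hφr T ⟨hT, le_rfl⟩).1.trans (hφr T ⟨hT, le_rfl⟩).2
  have hr : 0 < 1 - r := by linarith
  let e : ℕ → ℕ → ℝ := fun n j => if j = n then 1 else 0
  have he1 : ∀ n j, |e n j| ≤ 1 := fun n j => by dsimp only [e]; split_ifs <;> simp
  -- The forward equation asks for a geometric majorant; with ratio `1 / 2` the value `1` at `j = n`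
  -- forces the factor `2 ^ n`.
  have heb : ∀ n j, |e n j| ≤ 2 ^ n * (1 / 2 : ℝ) ^ j := fun n j => by
    dsimp only [e]
    split_ifs with h
    · rw [h, ← mul_pow]; norm_num
    · simp only [abs_zero]; positivity
  have hes : ∀ n, (e n).support.Finite := fun n =>
    (Set.finite_singleton n).subset fun j hj => by
      by_contra h
      exact hj (if_neg h)
  have hfwd := fun (n : ℕ) (u : ℝ) (hu : 0 ≤ u) =>
    hZ.integral_eq hEnv.lam_measurable hEnv.lam_nonneg hEnv.lam_integrable hEnv.p_measurable
      (hes n) (by norm_num) (by norm_num) (heb n) hu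
  set q : ℕ → ℝ → ℝ := fun n u => ∫ ω, e n (Z u.toNNReal ω) ∂P with hq
  set γ : ℕ → ℝ → ℝ := fun n u => ∫ ω, generator lam p u (e n) (Z u.toNNReal ω) ∂P with hγ
  have hqac := fun n => absolutelyContinuousOnInterval_of_eq_integral (F := q n) (g := γ n) hT
    (hfwd n T hT).1 (fun u hu => (hfwd n u hu.1).2)
  set F : ℕ → ℝ → ℝ := fun N u => ∑ n ∈ Finset.range N, φ u ^ n * q n u with hF
  have hFac : ∀ N, AbsolutelyContinuousOnInterval (F N) 0 T := fun N =>
    absolutelyContinuousOnInterval_sum _ fun n _ =>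
      (absolutelyContinuousOnInterval_pow n hφac).fun_mul (hqac n).1
  -- the truncated functions `j ↦ φ u ^ j` and their total derivatives along the process
  let τ : ℕ → ℝ → ℕ → ℝ := fun N u j => if j < N then φ u ^ j else 0
  let D : ℕ → ℝ → ℕ → ℝ := fun N u j =>
    (if j < N then (j : ℝ) * φ u ^ (j - 1) * -(lam u * (offspringPgf θ (a u) (φ u) - φ u)) else 0)
      + generator lam p u (τ N u) j
  have hτb : ∀ N, ∀ u ∈ Set.Icc 0 T, ∀ j, |τ N u j| ≤ 1 * r ^ j := fun N u hu j => by
    dsimp only [τ]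
    rw [one_mul]
    split_ifs
    · rw [abs_of_nonneg (pow_nonneg (hφr u hu).1 _)]
      exact pow_le_pow_left₀ (hφr u hu).1 (hφr u hu).2 _
    · simpa using pow_nonneg hr0 j
  have hτ1 : ∀ N, ∀ u ∈ Set.Icc 0 T, ∀ j, |τ N u j| ≤ 1 := fun N u hu j =>
    (hτb N u hu j).trans (by rw [one_mul]; exact pow_le_one₀ hr0 hr1.le)
  have hFτ : ∀ N u, F N u = ∫ ω, τ N u (Z u.toNNReal ω) ∂P := fun N u => by
    simp only [hF, hq, τ]
    simp_rw [← sum_range_mul_ite N (fun n => φ u ^ n)]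
    rw [integral_finsetSum _ fun n _ =>
      (integrable_comp_nat (f := e n) (hZ.measurable _) (he1 n)).const_mul _]
    simp_rw [integral_const_mul]
  have hFlim : ∀ u ∈ Set.Icc 0 T,
      Tendsto (fun N => F N u) atTop (𝓝 (∫ ω, φ u ^ Z u.toNNReal ω ∂P)) := fun u hu => by
    simp_rw [hFτ]
    exact tendsto_integral_comp_nat (f := fun j => φ u ^ j) (hZ.measurable _)
      (fun N j => hτ1 N u hu j) (fun j => tendsto_ite_lt _ j)
  have hpgf : ∀ u ∈ Set.Icc 0 T, HasSum (fun k : ℕ => (p u k).toReal * φ u ^ k)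
      (offspringPgf θ (a u) (φ u)) := fun u hu =>
    hEnv.pgf u hu.1 _ (hφr u hu).1 ((hφr u hu).2.trans hr1.le)
  have hh : ∀ u ∈ Set.Icc 0 T, |offspringPgf θ (a u) (φ u) - φ u| ≤ 2 := fun u hu => by
    have h0 := (hφr u hu).1
    have h1 : φ u ≤ 1 := (hφr u hu).2.trans hr1.le
    have h2 := abs_tsum_pmf_mul_le (p u) (g := fun k => φ u ^ k) (C := 1) fun k => by
      rw [abs_of_nonneg (pow_nonneg h0 k)]; exact pow_le_one₀ h0 h1
    rw [(hpgf u hu).tsum_eq] at h2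
    refine (abs_sub _ _).trans ?_
    rw [abs_of_nonneg h0]
    linarith
  -- Uniform in `N` and `j`, hence a dominating function for both the expectation and the time
  -- integral. Each of the two terms of `D` contributes `2 / (1 - r)`.
  have hDb : ∀ N, ∀ u ∈ Set.Icc 0 T, ∀ j, |D N u j| ≤ lam u * (4 / (1 - r)) := by
    intro N u hu j
    have hl := hEnv.lam_nonneg u hu.1
    have h1 : |generator lam p u (τ N u) j| ≤ lam u * (2 * 1 / (1 - r)) :=
      abs_generator_le hr0 hr1 (hτb N u hu) hl j
    have h2 : (j : ℝ) * φ u ^ (j - 1) ≤ 1 / (1 - r) := by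
      refine le_trans ?_ (natCast_mul_pow_pred_le hr0 hr1 j)
      have := (hφr u hu).1
      have := (hφr u hu).2
      gcongr
    have h3 : |if j < N then (j : ℝ) * φ u ^ (j - 1) *
        -(lam u * (offspringPgf θ (a u) (φ u) - φ u)) else 0| ≤ 1 / (1 - r) * (lam u * 2) := by
      split_ifs
      · rw [abs_mul, abs_neg, abs_mul (lam u), abs_of_nonneg hl,
          abs_of_nonneg (mul_nonneg (Nat.cast_nonneg j) (pow_nonneg (hφr u hu).1 _))]
        have := hh u hu
        gcongr
      · rw [abs_zero]; positivity
    calc |D N u j| ≤ _ := abs_add_le _ _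
      _ ≤ 1 / (1 - r) * (lam u * 2) + lam u * (2 * 1 / (1 - r)) := add_le_add h3 h1
      _ = lam u * (4 / (1 - r)) := by ring
  -- Without truncation the derivative of `φ ^ j` and the generator term cancel for every `j`.
  have hDlim : ∀ u ∈ Set.Icc 0 T,
      Tendsto (fun N => ∫ ω, D N u (Z u.toNNReal ω) ∂P) atTop (𝓝 0) := by
    intro u hu
    have h := tendsto_integral_comp_nat (P := P) (X := Z u.toNNReal) (g := fun N => D N u)
      (f := fun j => (j : ℝ) * φ u ^ (j - 1) * -(lam u * (offspringPgf θ (a u) (φ u) - φ u)) +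
        generator lam p u (fun j => φ u ^ j) j) (hZ.measurable _)
      (fun N j => hDb N u hu j) (fun j => (tendsto_ite_lt (fun j => (j : ℝ) * φ u ^ (j - 1) *
          -(lam u * (offspringPgf θ (a u) (φ u) - φ u))) j).add
        (tendsto_generator (fun N j => hτ1 N u hu j)
          (fun j => tendsto_ite_lt (fun j => φ u ^ j) j) j))
    have h0 : ∀ j : ℕ, (j : ℝ) * φ u ^ (j - 1) *
        -(lam u * (offspringPgf θ (a u) (φ u) - φ u)) +
        generator lam p u (fun j => φ u ^ j) j = 0 := fun j => by
      rw [generator_pow (hpgf u hu)]; ring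
    simpa only [h0, integral_zero] using h
  have hFd : ∀ N, ∀ᵐ u, u ∈ Set.Ioo 0 T →
      deriv (F N) u = ∫ ω, D N u (Z u.toNNReal ω) ∂P := by
    intro N
    filter_upwards [hφd, ae_all_iff.mpr fun n => (hqac n).2] with u hu1 hu2 hmem
    have hmem' := Set.Ioo_subset_Icc_self hmem
    have h1 : HasDerivAt (F N) (∑ n ∈ Finset.range N,
        (((n : ℝ) * φ u ^ (n - 1) * -(lam u * (offspringPgf θ (a u) (φ u) - φ u))) * q n u +
          φ u ^ n * γ n u)) u :=
      HasDerivAt.fun_sum fun n _ => ((hu1 hmem).fun_pow n).fun_mul (hu2 n hmem)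
    rw [h1.deriv, Finset.sum_add_distrib]
    have hgb : ∀ n j, |generator lam p u (e n) j| ≤ _ := fun n j =>
      abs_generator_le (by norm_num) (by norm_num) (heb n) (hEnv.lam_nonneg u hmem.1.le) j
    have h2 : ∀ j, D N u j = ∑ n ∈ Finset.range N,
        ((n : ℝ) * φ u ^ (n - 1) * -(lam u * (offspringPgf θ (a u) (φ u) - φ u))) * e n j +
        ∑ n ∈ Finset.range N, φ u ^ n * generator lam p u (e n) j := fun j => by
      rw [← generator_sum _ _ _ (fun n => ⟨1, he1 n⟩)]
      simp only [D, τ, e, sum_range_mul_ite]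
    simp_rw [h2]
    have hi1 : ∀ n ∈ Finset.range N, Integrable (fun ω =>
        ((n : ℝ) * φ u ^ (n - 1) * -(lam u * (offspringPgf θ (a u) (φ u) - φ u))) *
          e n (Z u.toNNReal ω)) P := fun n _ =>
      (integrable_comp_nat (f := e n) (hZ.measurable _) (he1 n)).const_mul _
    have hi2 : ∀ n ∈ Finset.range N, Integrable (fun ω =>
        φ u ^ n * generator lam p u (e n) (Z u.toNNReal ω)) P := fun n _ =>
      (integrable_comp_nat (f := generator lam p u (e n)) (hZ.measurable _) (hgb n)).const_mul _
    rw [integral_add (integrable_finsetSum _ hi1) (integrable_finsetSum _ hi2),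
      integral_finsetSum _ hi1, integral_finsetSum _ hi2]
    simp_rw [integral_const_mul]
    rfl
  have hne : ∀ᵐ u : ℝ, u ≠ T := by simp [ae_iff, measure_singleton]
  have hint : Tendsto (fun N => ∫ u in (0 : ℝ)..T, deriv (F N) u) atTop
      (𝓝 (∫ _ in (0 : ℝ)..T, (0 : ℝ))) := by
    refine intervalIntegral.tendsto_integral_filter_of_dominated_convergence
      (fun u => lam u * (4 / (1 - r))) (Eventually.of_forall fun N => ?_)
      (Eventually.of_forall fun N => ?_) ((hEnv.lam_integrable T hT).mul_const _) ?_
    · exact (measurable_deriv (F N)).aestronglyMeasurable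
    · filter_upwards [hFd N, hne] with u hu hu' hmem
      rw [Set.uIoc_of_le hT] at hmem
      rw [hu ⟨hmem.1, lt_of_le_of_ne hmem.2 hu'⟩]
      have hmem' : u ∈ Set.Icc 0 T := ⟨hmem.1.le, hmem.2⟩
      refine (norm_integral_le_of_norm_le_const (Eventually.of_forall fun ω => ?_)).trans_eq
        (by rw [probReal_univ, mul_one])
      exact hDb N u hmem' _
    · filter_upwards [ae_all_iff.mpr hFd, hne] with u hu hu' hmem
      rw [Set.uIoc_of_le hT] at hmem
      simp_rw [fun N => hu N ⟨hmem.1, lt_of_le_of_ne hmem.2 hu'⟩]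
      exact hDlim u ⟨hmem.1.le, hmem.2⟩
  simp_rw [fun N => (hFac N).integral_deriv_eq_sub] at hint
  rw [intervalIntegral.integral_zero] at hint
  have h1 := (hFlim T ⟨hT, le_rfl⟩).sub (hFlim 0 ⟨le_rfl, hT⟩)
  have h2 := tendsto_nhds_unique h1 hint
  have h3 : ∫ ω, φ 0 ^ Z (0 : ℝ).toNNReal ω ∂P = φ 0 := by
    rw [Real.toNNReal_zero, integral_congr_ae (g := fun _ => φ 0)
      (hZ.start.mono fun ω hω => by simp [hω])]
    simp
  rw [h3, hφT, hTdef, Real.toNNReal_coe] at h2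
  linarith

end GeneratingFunction

/-! ### Survival probability, mean and conditional Laplace transform -/

section Moments

variable {Ω : Type*} {m : MeasurableSpace Ω} {P : Measure Ω} [IsProbabilityMeasure P]
  {ℱ : Filtration ℝ≥0 m} {Z : ℝ≥0 → Ω → ℕ} {θ : ℝ} {lam a : ℝ → ℝ} {p : ℝ → PMF ℕ}

/-- `P (Z_t > 0) ^ (-θ)`, in closed form. -/
noncomputable def survivalScale (θ : ℝ) (lam a : ℝ → ℝ) (t : ℝ) : ℝ :=
  V θ lam a t + (1 + θ * mu lam a t ^ (-θ)) / (1 + θ)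

lemma IsThetaPositiveEnvironment.V_mono (hEnv : IsThetaPositiveEnvironment θ lam a p) {s t : ℝ}
    (hs : 0 ≤ s) (hst : s ≤ t) : V θ lam a s ≤ V θ lam a t := by
  have hθ := hEnv.theta_pos
  have ht := hs.trans hst
  have hI : ∀ t, 0 ≤ t → IntervalIntegrable (fun u => mu lam a u ^ (-θ) * lam u) volume 0 t :=
    fun t ht => by
      simpa [mul_comm] using hEnv.intervalIntegrable_mul_mu ht (measurable_const (a := (1 : ℝ)))
        (C := 1) (fun _ _ => by simp) (-θ)
  have h1 : 0 ≤ ∫ u in s..t, mu lam a u ^ (-θ) * lam u :=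
    intervalIntegral.integral_nonneg hst fun u hu =>
      mul_nonneg (Real.rpow_nonneg (mu_pos u).le _) (hEnv.lam_nonneg u (hs.trans hu.1))
  rw [← intervalIntegral.integral_interval_sub_left (hI t ht) (hI s hs)] at h1
  rw [V, V]
  exact mul_le_mul_of_nonneg_left (by linarith) (by positivity)

lemma IsThetaPositiveEnvironment.V_nonneg (hEnv : IsThetaPositiveEnvironment θ lam a p) {t : ℝ}
    (ht : 0 ≤ t) : 0 ≤ V θ lam a t := by
  simpa [V] using hEnv.V_mono le_rfl ht

lemma IsThetaPositiveEnvironment.survivalScale_pos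
    (hEnv : IsThetaPositiveEnvironment θ lam a p) {t : ℝ} (ht : 0 ≤ t) :
    0 < survivalScale θ lam a t := by
  have hθ := hEnv.theta_pos
  have := Real.rpow_pos_of_pos (mu_pos (lam := lam) (a := a) t) (-θ)
  exact add_pos_of_nonneg_of_pos (hEnv.V_nonneg ht) (by positivity)

/-- The generating function in terms of `survivalScale`. -/
lemma integral_pow_eq_survivalScale (hEnv : IsThetaPositiveEnvironment θ lam a p)
    (hZ : IsMarkovBranchingProcess lam p P ℱ Z) (t : ℝ≥0) {s : ℝ} (hs0 : 0 ≤ s) (hs1 : s < 1) :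
    ∫ ω, s ^ Z t ω ∂P = 1 - (mu lam a t ^ (-θ) * (1 - s) ^ (-θ) +
        (survivalScale θ lam a t - mu lam a t ^ (-θ))) ^ (-(1 / θ)) := by
  have hθ := hEnv.theta_pos
  rw [integral_pow_eq hEnv hZ t hs0 hs1]
  congr 3
  rw [survivalScale]
  field_simp
  ring

lemma real_eq_zero (hEnv : IsThetaPositiveEnvironment θ lam a p)
    (hZ : IsMarkovBranchingProcess lam p P ℱ Z) (t : ℝ≥0) :
    P.real {ω | Z t ω = 0} = 1 - survivalScale θ lam a t ^ (-(1 / θ)) := by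
  have h := integral_pow_eq_survivalScale hEnv hZ t le_rfl one_pos
  rw [sub_zero, Real.one_rpow, mul_one, add_sub_cancel] at h
  rw [← h]
  -- Uses `0 ^ 0 = 1`: the generating function at `0` is the extinction probability.
  have h1 : (fun ω => (0 : ℝ) ^ Z t ω) = Set.indicator {ω | Z t ω = 0} 1 := by
    ext ω
    by_cases hω : Z t ω = 0 <;> simp [hω]
  have h2 : MeasurableSet {ω | Z t ω = 0} := hZ.measurable t (measurableSet_singleton 0)
  rw [h1, integral_indicator_one h2]

lemma survivalProb_eq_one_sub (hZ : IsMarkovBranchingProcess lam p P ℱ Z) (t : ℝ≥0) :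
    survivalProb P Z t = 1 - P.real {ω | Z t ω = 0} := by
  have h : MeasurableSet {ω | Z t ω = 0} := hZ.measurable t (measurableSet_singleton 0)
  rw [survivalProb, ← probReal_compl_eq_one_sub h]
  congr 1
  ext ω
  simp [Nat.pos_iff_ne_zero]

lemma survivalProb_eq (hEnv : IsThetaPositiveEnvironment θ lam a p)
    (hZ : IsMarkovBranchingProcess lam p P ℱ Z) (t : ℝ≥0) :
    survivalProb P Z t = survivalScale θ lam a t ^ (-(1 / θ)) := by
  rw [survivalProb_eq_one_sub hZ, real_eq_zero hEnv hZ]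
  ring

lemma survivalProb_pos (hEnv : IsThetaPositiveEnvironment θ lam a p)
    (hZ : IsMarkovBranchingProcess lam p P ℱ Z) (t : ℝ≥0) : 0 < survivalProb P Z t := by
  rw [survivalProb_eq hEnv hZ]
  exact Real.rpow_pos_of_pos (hEnv.survivalScale_pos t.coe_nonneg) _

/-- With `x = 1 - s`, moving `1 / x` inside the power turns the slope into `(E + A * x ^ θ) ^ (-(1 /
θ))`, which tends to `E ^ (-(1 / θ)) = μ`. -/
lemma tendsto_pgf_slope (hEnv : IsThetaPositiveEnvironment θ lam a p)
    (hZ : IsMarkovBranchingProcess lam p P ℱ Z) (t : ℝ≥0) :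
    Tendsto (fun n : ℕ => (1 - ∫ ω, (1 - 1 / ((n : ℝ) + 1)) ^ Z t ω ∂P) / (1 / ((n : ℝ) + 1)))
      atTop (𝓝 (mu lam a t)) := by
  have hθ := hEnv.theta_pos
  set E := mu lam a t ^ (-θ) with hE
  have hEpos : 0 < E := Real.rpow_pos_of_pos (mu_pos _) _
  set A := survivalScale θ lam a t - E with hA
  have hD := hEnv.survivalScale_pos t.coe_nonneg
  have h1 : Tendsto (fun n : ℕ => (E + A * (1 / ((n : ℝ) + 1)) ^ θ) ^ (-(1 / θ))) atTop
      (𝓝 ((E + A * 0 ^ θ) ^ (-(1 / θ)))) := by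
    have h2 : Tendsto (fun n : ℕ => (1 / ((n : ℝ) + 1)) ^ θ) atTop (𝓝 (0 ^ θ)) :=
      tendsto_one_div_add_atTop_nhds_zero_nat.rpow_const (Or.inr hθ.le)
    refine ((h2.const_mul A).const_add E).rpow_const (Or.inl ?_)
    rw [Real.zero_rpow hθ.ne', mul_zero, add_zero]
    exact hEpos.ne'
  have h3 : (E + A * 0 ^ θ) ^ (-(1 / θ)) = mu lam a t := by
    rw [Real.zero_rpow hθ.ne', mul_zero, add_zero, hE, ← Real.rpow_mul (mu_pos _).le,
      show -θ * -(1 / θ) = 1 by field_simp, Real.rpow_one]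
  rw [h3] at h1
  refine h1.congr fun n => ?_
  set x : ℝ := 1 / ((n : ℝ) + 1) with hx
  have hx0 : 0 < x := by positivity
  have hx1 : x ≤ 1 := by
    rw [hx, div_le_one (by positivity)]
    linarith [n.cast_nonneg (α := ℝ)]
  rw [integral_pow_eq_survivalScale hEnv hZ t (by linarith) (by linarith), sub_sub_cancel,
    sub_sub_cancel, ← hE, ← hA]
  have hxθ : x ^ θ * x ^ (-θ) = 1 := by
    rw [← Real.rpow_add hx0, add_neg_cancel, Real.rpow_zero]
  have hfac : E + A * x ^ θ = x ^ θ * (E * x ^ (-θ) + A) := by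
    linear_combination (-E) * hxθ
  have hpos : 0 ≤ E * x ^ (-θ) + A := by
    have h4 : 1 ≤ x ^ (-θ) := Real.one_le_rpow_of_pos_of_le_one_of_nonpos hx0 hx1 (by linarith)
    have : E ≤ E * x ^ (-θ) := le_mul_of_one_le_right hEpos.le h4
    linarith
  rw [hfac, Real.mul_rpow (Real.rpow_nonneg hx0.le _) hpos, ← Real.rpow_mul hx0.le,
    show θ * -(1 / θ) = -1 by field_simp, Real.rpow_neg_one]
  field_simp

/-- The quotient `(1 - s ^ Z) / (1 - s)` is the geometric sum of `s ^ j` over `j < Z`, which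
increases to `Z` as `s ↑ 1`. Monotone convergence gives finiteness and value of the mean together.
-/
lemma integrable_and_integral_eq_mu (hEnv : IsThetaPositiveEnvironment θ lam a p)
    (hZ : IsMarkovBranchingProcess lam p P ℱ Z) (t : ℝ≥0) :
    Integrable (fun ω => (Z t ω : ℝ)) P ∧ ∫ ω, (Z t ω : ℝ) ∂P = mu lam a t := by
  let s : ℕ → ℝ := fun n => 1 - 1 / ((n : ℝ) + 1)
  have hs0 : ∀ n, 0 ≤ s n := fun n => by
    have : 1 / ((n : ℝ) + 1) ≤ 1 := by
      rw [div_le_one (by positivity)]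
      linarith [n.cast_nonneg (α := ℝ)]
    simp only [s]
    linarith
  have hs1 : ∀ n, s n < 1 := fun n => by
    have : 0 < 1 / ((n : ℝ) + 1) := by positivity
    simp only [s]
    linarith
  have hsmono : Monotone s := fun i j hij => by
    simp only [s]
    gcongr
  have hslim : Tendsto s atTop (𝓝 1) := by
    simpa only [sub_zero] using tendsto_one_div_add_atTop_nhds_zero_nat.const_sub (1 : ℝ)
  have hcast : Measurable fun ω => (Z t ω : ℝ) := measurable_from_nat.comp (hZ.measurable t)
  have hlim := lintegral_tendsto_of_tendsto_of_monotone (μ := P)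
    (f := fun n ω => ENNReal.ofReal (∑ j ∈ Finset.range (Z t ω), s n ^ j))
    (F := fun ω => ENNReal.ofReal (Z t ω))
    (fun n => ((measurable_from_nat (f := fun i => ENNReal.ofReal
      (∑ j ∈ Finset.range i, s n ^ j))).comp (hZ.measurable t)).aemeasurable)
    (Eventually.of_forall fun ω i j hij => ENNReal.ofReal_le_ofReal
      (Finset.sum_le_sum fun k _ => pow_le_pow_left₀ (hs0 i) (hsmono hij) k))
    (Eventually.of_forall fun ω => ENNReal.tendsto_ofReal (by
      have := tendsto_finsetSum (Finset.range (Z t ω)) fun j _ => hslim.pow j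
      simpa using this))
  have hval : ∀ n, ∫⁻ ω, ENNReal.ofReal (∑ j ∈ Finset.range (Z t ω), s n ^ j) ∂P =
      ENNReal.ofReal ((1 - ∫ ω, (1 - 1 / ((n : ℝ) + 1)) ^ Z t ω ∂P) / (1 / ((n : ℝ) + 1))) := by
    intro n
    have hpow : ∀ j : ℕ, |s n ^ j| ≤ 1 := fun j => by
      rw [abs_of_nonneg (pow_nonneg (hs0 n) j)]
      exact pow_le_one₀ (hs0 n) (hs1 n).le
    have hI : Integrable (fun ω => s n ^ Z t ω) P :=
      integrable_comp_nat (f := fun j => s n ^ j) (hZ.measurable t) hpow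
    have hgeom : ∀ i : ℕ, ∑ j ∈ Finset.range i, s n ^ j = (1 - s n ^ i) / (1 - s n) := fun i => by
      rw [geom_sum_eq (hs1 n).ne, ← neg_sub 1 (s n ^ i), ← neg_sub 1 (s n), neg_div_neg_eq]
    simp_rw [hgeom]
    rw [← ofReal_integral_eq_lintegral_ofReal
      (f := fun ω => (1 - s n ^ Z t ω) / (1 - s n)) (((integrable_const 1).sub hI).div_const _)
      (Eventually.of_forall fun ω => div_nonneg
        (sub_nonneg.mpr (pow_le_one₀ (hs0 n) (hs1 n).le)) (by linarith [hs1 n])),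
      integral_div, integral_sub (integrable_const 1) hI]
    simp [s]
  simp_rw [hval] at hlim
  have hmean := tendsto_nhds_unique hlim (ENNReal.tendsto_ofReal (tendsto_pgf_slope hEnv hZ t))
  constructor
  · refine ⟨hcast.aestronglyMeasurable, ?_⟩
    rw [hasFiniteIntegral_iff_ofReal (Eventually.of_forall fun ω => Nat.cast_nonneg _), hmean]
    exact ENNReal.ofReal_lt_top
  · rw [integral_eq_lintegral_of_nonneg_ae (Eventually.of_forall fun ω => Nat.cast_nonneg _)
      hcast.aestronglyMeasurable, hmean, ENNReal.toReal_ofReal (mu_pos _).le]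

lemma mu_mul_rpow (hEnv : IsThetaPositiveEnvironment θ lam a p) (t : ℝ) {x : ℝ} (hx : 0 ≤ x) :
    mu lam a t * x ^ (1 / θ) = (mu lam a t ^ θ * x) ^ (1 / θ) := by
  have hθ := hEnv.theta_pos
  rw [Real.mul_rpow (Real.rpow_nonneg (mu_pos t).le _) hx, ← Real.rpow_mul (mu_pos t).le,
    mul_one_div_cancel hθ.ne', Real.rpow_one]

lemma condMean_eq (hEnv : IsThetaPositiveEnvironment θ lam a p)
    (hZ : IsMarkovBranchingProcess lam p P ℱ Z) (t : ℝ≥0) :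
    condMean P Z t = mu lam a t * survivalScale θ lam a t ^ (1 / θ) := by
  obtain ⟨h1, h2⟩ := integrable_and_integral_eq_mu hEnv hZ t
  rw [condMean, integral_condSurvival hZ t (f := fun j => (j : ℝ)) h1, h2, survivalProb_eq hEnv hZ,
    Real.rpow_neg (hEnv.survivalScale_pos t.coe_nonneg).le, inv_inv]
  simp [mul_comm]

lemma condMean_pos (hEnv : IsThetaPositiveEnvironment θ lam a p)
    (hZ : IsMarkovBranchingProcess lam p P ℱ Z) (t : ℝ≥0) : 0 < condMean P Z t := by
  rw [condMean_eq hEnv hZ]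
  exact mul_pos (mu_pos _) (Real.rpow_pos_of_pos (hEnv.survivalScale_pos t.coe_nonneg) _)

lemma condLaplace_zero (hEnv : IsThetaPositiveEnvironment θ lam a p)
    (hZ : IsMarkovBranchingProcess lam p P ℱ Z) (t : ℝ≥0) : condLaplace P Z 0 t = 1 := by
  have h := integral_condSurvival hZ t (f := fun _ => (1 : ℝ)) (integrable_const 1)
  simp only [integral_const, probReal_univ, smul_eq_mul, mul_one, one_mul] at h
  rw [← survivalProb_eq_one_sub hZ, inv_mul_cancel₀ (survivalProb_pos hEnv hZ t).ne'] at h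
  simp [condLaplace, h]

/-- Since `condMean ^ (-θ) = (μ ^ θ * D)⁻¹`, a factor `D` comes out of the generating function and
cancels against the survival probability. What remains depends only on two quantities with evident
limits in the critical case. -/
lemma condLaplace_eq (hEnv : IsThetaPositiveEnvironment θ lam a p)
    (hZ : IsMarkovBranchingProcess lam p P ℱ Z) {w : ℝ} (hw : 0 < w) (t : ℝ≥0) :
    condLaplace P Z w t =
      1 - ((condMean P Z t * (1 - Real.exp (-(w * (condMean P Z t)⁻¹)))) ^ (-θ) +
        (1 - (mu lam a t ^ θ * survivalScale θ lam a t)⁻¹)) ^ (-(1 / θ)) := by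
  have hθ := hEnv.theta_pos
  have hm := condMean_pos hEnv hZ t
  have hD := hEnv.survivalScale_pos t.coe_nonneg
  set D := survivalScale θ lam a t with hDdef
  set M := condMean P Z t with hM
  set s := Real.exp (-(w * M⁻¹)) with hs
  have hs0 : 0 < s := Real.exp_pos _
  have hs1 : s < 1 := Real.exp_lt_one_iff.mpr (by have := mul_pos hw (inv_pos.mpr hm); linarith)
  have hx : 0 < 1 - s := by linarith
  have hU : 0 < mu lam a t ^ θ := Real.rpow_pos_of_pos (mu_pos _) _
  have hE : mu lam a t ^ (-θ) = (mu lam a t ^ θ)⁻¹ := Real.rpow_neg (mu_pos _).le _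
  have hMθ : M ^ (-θ) = (mu lam a t ^ θ * D)⁻¹ := by
    rw [hM, condMean_eq hEnv hZ, ← hDdef, mu_mul_rpow hEnv _ hD.le,
      ← Real.rpow_mul (mul_nonneg hU.le hD.le), show 1 / θ * -θ = -1 by field_simp,
      Real.rpow_neg_one]
  have hexp : ∀ ω, Real.exp (-(w * (Z t ω : ℝ) / M)) = s ^ Z t ω := fun ω => by
    rw [hs, ← Real.exp_nat_mul]
    congr 1
    ring
  have hI : Integrable (fun ω => s ^ Z t ω) P :=
    integrable_comp_nat (f := fun j => s ^ j) (C := 1) (hZ.measurable t) fun j => by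
      rw [abs_of_nonneg (pow_nonneg hs0.le j)]
      exact pow_le_one₀ hs0.le hs1.le
  have h1 := integral_condSurvival hZ t (f := fun j => s ^ j) hI
  rw [condLaplace]
  simp_rw [← hM, hexp]
  rw [h1, integral_pow_eq_survivalScale hEnv hZ t hs0.le hs1, survivalProb_eq hEnv hZ,
    real_eq_zero hEnv hZ, ← hDdef]
  have hEle : mu lam a t ^ (-θ) ≤ mu lam a t ^ (-θ) * (1 - s) ^ (-θ) :=
    le_mul_of_one_le_right (Real.rpow_nonneg (mu_pos _).le _)
      (Real.one_le_rpow_of_pos_of_le_one_of_nonpos hx (by linarith) (by linarith))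
  have hfac : mu lam a t ^ (-θ) * (1 - s) ^ (-θ) + (D - mu lam a t ^ (-θ)) =
      D * ((M * (1 - s)) ^ (-θ) + (1 - (mu lam a t ^ θ * D)⁻¹)) := by
    rw [Real.mul_rpow hm.le hx.le, hMθ, hE]
    field_simp
  have hB : 0 ≤ (M * (1 - s)) ^ (-θ) + (1 - (mu lam a t ^ θ * D)⁻¹) := by
    refine nonneg_of_mul_nonneg_right (a := D) ?_ hD
    rw [← hfac]
    linarith
  rw [hfac, Real.mul_rpow hD.le hB]
  have := (Real.rpow_pos_of_pos hD (-(1 / θ))).ne'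
  field_simp
  ring

end Moments

/-! ### Real-variable limits comparing the survival scale with `V` -/

section Asymptotics

/-- This is the derivative of `h ↦ 1 - exp (-(w * h))` at `0`, taken along `h = 1 / M`. -/
lemma tendsto_mul_one_sub_exp {ι : Type*} {l : Filter ι} {M : ι → ℝ} (hM : Tendsto M l atTop)
    (w : ℝ) : Tendsto (fun t => M t * (1 - Real.exp (-(w * (M t)⁻¹)))) l (𝓝 w) := by
  have hd : HasDerivAt (fun h : ℝ => 1 - Real.exp (-(w * h))) w 0 := by
    have h1 : HasDerivAt (fun h : ℝ => -(w * h)) (-w) 0 := by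
      exact (((hasDerivAt_id (0 : ℝ)).const_mul w).neg).congr_deriv (by ring)
    simpa using h1.exp.const_sub 1
  have h2 := hd.tendsto_slope_zero_right.comp (tendsto_inv_atTop_nhdsGT_zero.comp hM)
  refine h2.congr fun t => ?_
  simp

variable {ι : Type*} {θ : ℝ} {U W : ι → ℝ} {l : Filter ι}

lemma tendsto_scale_div (hθ : 0 < θ) (hW : Tendsto W l atTop)
    (hUW : Tendsto (fun t => U t * W t) l atTop) :
    Tendsto (fun t => (W t + (1 + θ * (U t)⁻¹) / (1 + θ)) / W t) l (𝓝 1) := by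
  have h : Tendsto (fun t => 1 + ((1 + θ)⁻¹ * (W t)⁻¹ + θ / (1 + θ) * (U t * W t)⁻¹)) l
      (𝓝 (1 + ((1 + θ)⁻¹ * 0 + θ / (1 + θ) * 0))) :=
    ((hW.inv_tendsto_atTop.const_mul _).add (hUW.inv_tendsto_atTop.const_mul _)).const_add 1
  simp only [mul_zero, add_zero] at h
  refine h.congr' ?_
  filter_upwards [hW.eventually_gt_atTop 0, hUW.eventually_gt_atTop 0] with t h1 h2
  have hU : U t ≠ 0 := fun h0 => by simp [h0] at h2
  field_simp

/-- The delicate point is that `W` must diverge: were it bounded, the scale could only diverge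
through `U⁻¹`, and then `U` times the scale would stay bounded. Monotonicity of `W` supplies the
dichotomy. -/
lemma scale_tendsto_atTop_iff {U W : ℝ≥0 → ℝ} (hθ : 0 < θ) (hU : ∀ t, 0 < U t)
    (hW0 : ∀ t, 0 ≤ W t) (hW : Monotone W) :
    (Tendsto (fun t => W t + (1 + θ * (U t)⁻¹) / (1 + θ)) atTop atTop ∧
      Tendsto (fun t => U t * (W t + (1 + θ * (U t)⁻¹) / (1 + θ))) atTop atTop) ↔
    (Tendsto W atTop atTop ∧ Tendsto (fun t => U t * W t) atTop atTop) := by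
  have hc0 : 0 ≤ (1 + θ)⁻¹ := by positivity
  have hc1 : (1 + θ)⁻¹ ≤ 1 := inv_le_one_of_one_le₀ (by linarith)
  have hd0 : 0 ≤ θ * (1 + θ)⁻¹ := by positivity
  have hd1 : θ * (1 + θ)⁻¹ ≤ 1 := by
    rw [← div_eq_mul_inv, div_le_one (by linarith)]; linarith
  have hsplit : ∀ t, W t + (1 + θ * (U t)⁻¹) / (1 + θ) =
      W t + (1 + θ)⁻¹ + θ * (1 + θ)⁻¹ * (U t)⁻¹ := fun t => by ring
  have hUsplit : ∀ t, U t * (W t + (1 + θ * (U t)⁻¹) / (1 + θ)) =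
      U t * (W t + (1 + θ)⁻¹) + θ * (1 + θ)⁻¹ := fun t => by
    have := (hU t).ne'
    field_simp
    ring
  simp_rw [hUsplit, hsplit]
  constructor
  · rintro ⟨h1, h2⟩
    have hWtop : Tendsto W atTop atTop := by
      rcases tendsto_atTop_of_monotone hW with h | ⟨B, hB⟩
      · exact h
      exfalso
      have hWB : ∀ t, W t ≤ B := fun t => hW.ge_of_tendsto hB t
      have hB0 : 0 ≤ B := (hW0 0).trans (hWB 0)
      -- The value `2 * (B + 1)` forces `B + 1 ≤ (U t)⁻¹`, so `U t` times the scale is at most `1 +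
      -- 1 < 4`.
      obtain ⟨t, ht1, ht2⟩ := ((h1.eventually_ge_atTop (2 * (B + 1))).and
        (h2.eventually_ge_atTop 4)).exists
      have hUt := hU t
      have h3 : U t * (W t + (1 + θ)⁻¹) ≤ U t * (B + 1) := by
        have := hWB t
        gcongr
      have h4 : θ * (1 + θ)⁻¹ * (U t)⁻¹ ≤ (U t)⁻¹ :=
        mul_le_of_le_one_left (inv_pos.mpr hUt).le hd1
      have h5 : B + 1 ≤ (U t)⁻¹ := by linarith [hWB t]
      have h6 : U t * (B + 1) ≤ U t * (U t)⁻¹ := by gcongr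
      rw [mul_inv_cancel₀ hUt.ne'] at h6
      linarith
    refine ⟨hWtop, ?_⟩
    -- Once `W ≥ 1 ≥ (1 + θ)⁻¹`, `U` times the scale is at most `2 * U * W + 1`.
    have h3 := (tendsto_atTop_add_const_right atTop (-1) h2).atTop_div_const (two_pos (α := ℝ))
    refine tendsto_atTop_mono' _ ?_ h3
    filter_upwards [hWtop.eventually_ge_atTop 1] with t ht
    have h4 : U t * (W t + (1 + θ)⁻¹) ≤ U t * (W t + W t) := by
      have := (hU t).le
      have := hc1.trans ht
      gcongr
    linarith
  · rintro ⟨h1, h2⟩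
    refine ⟨tendsto_atTop_mono (fun t => ?_) h1, tendsto_atTop_mono (fun t => ?_) h2⟩
    · have := mul_nonneg hd0 (inv_pos.mpr (hU t)).le
      linarith
    · have := mul_nonneg (hU t).le hc0
      linarith

lemma tendsto_rpow_atTop_iff {k : ℝ} (hk : 0 < k) (hW : ∀ t, 0 ≤ W t) :
    Tendsto (fun t => W t ^ k) l atTop ↔ Tendsto W l atTop := by
  refine ⟨fun h => ?_, fun h => (tendsto_rpow_atTop hk).comp h⟩
  refine ((tendsto_rpow_atTop (inv_pos.mpr hk)).comp h).congr fun t => ?_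
  simp [← Real.rpow_mul (hW t), hk.ne']

lemma tendsto_one_sub_rpow_neg_iff {k : ℝ} (hk : 0 < k) (hW : ∀ t, 0 < W t) :
    Tendsto (fun t => 1 - W t ^ (-k)) l (𝓝 1) ↔ Tendsto W l atTop := by
  constructor
  · intro h
    rw [← tendsto_rpow_atTop_iff hk fun t => (hW t).le]
    have h1 : Tendsto (fun t => W t ^ (-k)) l (𝓝[>] 0) := by
      refine tendsto_nhdsWithin_iff.mpr
        ⟨?_, Eventually.of_forall fun t => Real.rpow_pos_of_pos (hW t) _⟩
      simpa using h.const_sub 1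
    refine (tendsto_inv_nhdsGT_zero.comp h1).congr fun t => ?_
    simp [Real.rpow_neg (hW t).le]
  · intro h
    simpa using ((tendsto_rpow_neg_atTop hk).comp h).const_sub 1

end Asymptotics

/-! ### The criticality criterion and the limit theorems -/

section Critical

variable {Ω : Type*} {m : MeasurableSpace Ω} {P : Measure Ω} [IsProbabilityMeasure P]
  {ℱ : Filtration ℝ≥0 m} {Z : ℝ≥0 → Ω → ℕ} {θ : ℝ} {lam a : ℝ → ℝ} {p : ℝ → PMF ℕ}

lemma survivalScale_eq (t : ℝ) :
    survivalScale θ lam a t = V θ lam a t + (1 + θ * (mu lam a t ^ θ)⁻¹) / (1 + θ) := by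
  rw [survivalScale, Real.rpow_neg (mu_pos t).le]

lemma isCritical_iff_survivalScale (hEnv : IsThetaPositiveEnvironment θ lam a p)
    (hZ : IsMarkovBranchingProcess lam p P ℱ Z) :
    IsCritical P Z ↔
      Tendsto (fun t : ℝ≥0 => survivalScale θ lam a t) atTop atTop ∧
      Tendsto (fun t : ℝ≥0 => mu lam a t ^ θ * survivalScale θ lam a t) atTop atTop := by
  have hk : 0 < 1 / θ := one_div_pos.mpr hEnv.theta_pos
  have hD : ∀ t : ℝ≥0, 0 < survivalScale θ lam a t := fun t => hEnv.survivalScale_pos t.coe_nonneg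
  have hM : condMean P Z =
      fun t : ℝ≥0 => (mu lam a t ^ θ * survivalScale θ lam a t) ^ (1 / θ) := by
    ext t
    rw [condMean_eq hEnv hZ, mu_mul_rpow hEnv _ (hD t).le]
  rw [IsCritical, hM, tendsto_rpow_atTop_iff hk fun t : ℝ≥0 =>
    mul_nonneg (Real.rpow_nonneg (mu_pos _).le _) (hD t).le]
  simp_rw [real_eq_zero hEnv hZ]
  rw [tendsto_one_sub_rpow_neg_iff hk hD]

lemma isCritical_iff (hEnv : IsThetaPositiveEnvironment θ lam a p)
    (hZ : IsMarkovBranchingProcess lam p P ℱ Z) :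
    IsCritical P Z ↔
      Tendsto (fun t : ℝ≥0 => V θ lam a t) atTop atTop ∧
      Tendsto (fun t : ℝ≥0 => mu lam a t ^ θ * V θ lam a t) atTop atTop := by
  rw [isCritical_iff_survivalScale hEnv hZ]
  simp_rw [survivalScale_eq]
  exact scale_tendsto_atTop_iff (U := fun t : ℝ≥0 => mu lam a t ^ θ)
    (W := fun t : ℝ≥0 => V θ lam a t) hEnv.theta_pos
    (fun t => Real.rpow_pos_of_pos (mu_pos _) _) (fun t => hEnv.V_nonneg t.coe_nonneg)
    (fun s t hst => hEnv.V_mono s.2 hst)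

lemma tendsto_survivalScale_div_rpow (hEnv : IsThetaPositiveEnvironment θ lam a p)
    (hZ : IsMarkovBranchingProcess lam p P ℱ Z) (hcrit : IsCritical P Z) (k : ℝ) :
    Tendsto (fun t : ℝ≥0 => (survivalScale θ lam a t / V θ lam a t) ^ k) atTop (𝓝 1) := by
  obtain ⟨h1, h2⟩ := (isCritical_iff hEnv hZ).mp hcrit
  have h := tendsto_scale_div hEnv.theta_pos h1 h2
  simp_rw [← survivalScale_eq] at h
  simpa using h.rpow_const (p := k) (Or.inl one_ne_zero)

lemma survivalProb_isEquivalent (hEnv : IsThetaPositiveEnvironment θ lam a p)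
    (hZ : IsMarkovBranchingProcess lam p P ℱ Z) (hcrit : IsCritical P Z) :
    survivalProb P Z ~[atTop] fun t : ℝ≥0 => V θ lam a t ^ (-(1 / θ)) := by
  have hV := ((isCritical_iff hEnv hZ).mp hcrit).1.eventually_gt_atTop 0
  rw [isEquivalent_iff_tendsto_one (hV.mono fun t ht => (Real.rpow_pos_of_pos ht _).ne')]
  refine (tendsto_survivalScale_div_rpow hEnv hZ hcrit (-(1 / θ))).congr' ?_
  filter_upwards [hV] with t ht
  rw [Pi.div_apply, survivalProb_eq hEnv hZ,
    Real.div_rpow (hEnv.survivalScale_pos t.coe_nonneg).le ht.le]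

lemma condMean_isEquivalent (hEnv : IsThetaPositiveEnvironment θ lam a p)
    (hZ : IsMarkovBranchingProcess lam p P ℱ Z) (hcrit : IsCritical P Z) :
    condMean P Z ~[atTop] fun t : ℝ≥0 => mu lam a t * V θ lam a t ^ (1 / θ) := by
  have hV := ((isCritical_iff hEnv hZ).mp hcrit).1.eventually_gt_atTop 0
  rw [isEquivalent_iff_tendsto_one
    (hV.mono fun t ht => (mul_pos (mu_pos _) (Real.rpow_pos_of_pos ht _)).ne')]
  refine (tendsto_survivalScale_div_rpow hEnv hZ hcrit (1 / θ)).congr' ?_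
  filter_upwards [hV] with t ht
  rw [Pi.div_apply, condMean_eq hEnv hZ, mul_div_mul_left _ _ (mu_pos _).ne',
    Real.div_rpow (hEnv.survivalScale_pos t.coe_nonneg).le ht.le]

lemma tendsto_condLaplace (hEnv : IsThetaPositiveEnvironment θ lam a p)
    (hZ : IsMarkovBranchingProcess lam p P ℱ Z) (hcrit : IsCritical P Z) {w : ℝ} (hw : 0 < w) :
    Tendsto (condLaplace P Z w) atTop (𝓝 (1 - (1 + w ^ (-θ)) ^ (-(1 / θ)))) := by
  have hUD := ((isCritical_iff_survivalScale hEnv hZ).mp hcrit).2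
  rw [funext (condLaplace_eq hEnv hZ hw)]
  have h1 := (tendsto_mul_one_sub_exp hcrit.2 w).rpow_const (p := -θ) (Or.inl hw.ne')
  have h2 := h1.add (hUD.inv_tendsto_atTop.const_sub 1)
  rw [sub_zero, add_comm (w ^ (-θ))] at h2
  have hpos : 0 < w ^ (-θ) := Real.rpow_pos_of_pos hw _
  exact (h2.rpow_const (Or.inl (by positivity))).const_sub 1

end Critical

end ThetaBranching

theorem theorem4 {Ω : Type*} {m : MeasurableSpace Ω} (P : Measure Ω) [IsProbabilityMeasure P]
    (ℱ : Filtration ℝ≥0 m) (Z : ℝ≥0 → Ω → ℕ)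
    (θ : ℝ) (lam a : ℝ → ℝ) (p : ℝ → PMF ℕ)
    (hEnv : ThetaBranching.IsThetaPositiveEnvironment θ lam a p)
    (hZ : ThetaBranching.IsMarkovBranchingProcess lam p P ℱ Z) :
    (∀ t : ℝ≥0, 0 < ThetaBranching.survivalProb P Z t ∧
      Integrable (fun ω => (Z t ω : ℝ)) P ∧
      ∫ ω, (Z t ω : ℝ) ∂P = ThetaBranching.mu lam a t) ∧
    (ThetaBranching.IsCritical P Z ↔
      Tendsto (fun t : ℝ≥0 => ThetaBranching.V θ lam a t) atTop atTop ∧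
      Tendsto (fun t : ℝ≥0 => ThetaBranching.mu lam a t ^ θ * ThetaBranching.V θ lam a t)
        atTop atTop) ∧
    (ThetaBranching.IsCritical P Z →
      (ThetaBranching.survivalProb P Z ~[atTop]
        fun t : ℝ≥0 => ThetaBranching.V θ lam a t ^ (-(1 / θ))) ∧
      (ThetaBranching.condMean P Z ~[atTop]
        fun t : ℝ≥0 => ThetaBranching.mu lam a t * ThetaBranching.V θ lam a t ^ (1 / θ)) ∧
      ∀ w : ℝ, 0 ≤ w →
        Tendsto (ThetaBranching.condLaplace P Z w) atTop
          (𝓝 (if w = 0 then 1 else 1 - (1 + w ^ (-θ)) ^ (-(1 / θ))))) := by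
  refine ⟨fun t => ⟨ThetaBranching.survivalProb_pos hEnv hZ t,
    ThetaBranching.integrable_and_integral_eq_mu hEnv hZ t⟩,
    ThetaBranching.isCritical_iff hEnv hZ, fun hcrit =>
    ⟨ThetaBranching.survivalProb_isEquivalent hEnv hZ hcrit,
      ThetaBranching.condMean_isEquivalent hEnv hZ hcrit, fun w hw => ?_⟩⟩
  split_ifs with h
  · rw [h, funext (ThetaBranching.condLaplace_zero hEnv hZ)]
    exact tendsto_const_nhds
  · exact ThetaBranching.tendsto_condLaplace hEnv hZ hcrit (lt_of_le_of_ne hw (Ne.symm h))
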